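/- Let $\mathbb{R}^d$ carry the Euclidean norm $|\cdot|$ and Lebesgue measure $|\cdot|$, and for $E\subset\mathbb{R}^d$ and $\delta>0$ let $E_\delta=E+B(0,\delta)$. For $\alpha>0$, call $E$ **$\{\delta_i\}$-discrete $\alpha$-regular** if there is a sequence of positive numbers $\delta_i\to 0$ such that for every sufficiently small $\epsilon>0$ there is a constant $C_\epsilon$ with $$|E_{\delta_i}\cap B(x,r)|\le C_\epsilon\left(\frac{r}{\delta_i}\right)^{\alpha+\epsilon}\delta_i^{\,d-\epsilon}\qquad\text{for all } i,\ x\in\mathbb{R}^d,\ r\ge\delta_i .$$ For $k\ge 1$ and $\vec t=(t_1,\dots,t_k)$ with all $t_i>0$, let $$VS^k_{\vec t}(E)=\{(x_1,\dots,x_{k+1})\in E^{k+1}:\ |x_i-x_{i+1}|=t_i\ (1\le i\le k),\ x_1,\dots,x_{k+1}\text{ pairwise distinct}\}.$$ Let $\mathcal{A}_d(\alpha)$ be the class of compact $\{\delta_i\}$-discrete $\alpha$-regular sets $E\subset\mathbb{R}^d$ with $\dim_{\mathcal H}E=\alpha$ (the sequence $\{\delta_i\}$ may depend on $E$), and put $$g_d(VS^k_{\vec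 t},\alpha)=\sup\{\dim_{\mathcal H}VS^k_{\vec t}(E):\ E\in\mathcal{A}_d(\alpha)\}.$$ **Theorem.** For all integers $d\ge 2$ and $k\ge 1$, all gaps $\vec t\in(0,\infty)^k$ and all $\alpha>0$, $$g_d(VS^k_{\vec t},\alpha)\ \begin{cases} =(k+1)\alpha-k, & \frac{d+1}{2}\le\alpha\le d,\\[2pt] \le \frac{k(d-1)}{2}+\alpha, & \alpha\le\frac{d+1}{2}.\end{cases}$$ Moreover, the upper bounds hold for the lower Minkowski dimension: for every $E\in\mathcal{A}_d(\alpha)$, $\underline{\dim}_{\mathcal M}VS^k_{\vec t}(E)\le (k+1)\alpha-k$ if $\frac{d+1}{2}\le\alpha\le d$, and $\underline{\dim}_{\mathcal M}VS^k_{\vec t}(E)\le \frac{k(d-1)}{2}+\alpha$ if $\alpha\le\frac{d+1}{2}$. (Here $\underline{\dim}_{\mathcal M}A=\liminf_{r\to0^+}\log N(A,r)/\log(1/r)$, with $N(A,r)$ the least number of balls of radius $r$ covering $A$.) -/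

import Mathlib

open Set Filter Topology MeasureTheory
open scoped ENNReal NNReal

noncomputable section

/-- A set `E ⊆ ℝ^d` is `{δ_i}`-discrete `α`-regular: along some sequence of positive scales
`δ_i → 0`, for all sufficiently small `ε > 0`, the volume of `E_{δ_i} ∩ B(x, r)` is at most
`C_ε (r / δ_i)^(α + ε) δ_i^(d - ε)` for all `i`, all `x ∈ ℝ^d` and all `r ≥ δ_i`.
Here `Metric.thickening δ E` is the neighbourhood `E_δ = E + B(0, δ)`. -/
def IsDiscreteRegular {d : ℕ} (E : Set (EuclideanSpace ℝ (Fin d))) (α : ℝ) : Prop :=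
  ∃ δ : ℕ → ℝ, (∀ i, 0 < δ i) ∧ Tendsto δ atTop (𝓝 0) ∧
    ∃ ε₀ : ℝ, 0 < ε₀ ∧ ∀ ε : ℝ, 0 < ε → ε < ε₀ →
      ∃ C : ℝ, 0 < C ∧ ∀ (i : ℕ) (x : EuclideanSpace ℝ (Fin d)) (r : ℝ), δ i ≤ r →
        volume (Metric.thickening (δ i) E ∩ Metric.ball x r) ≤
          ENNReal.ofReal (C * (r / δ i) ^ (α + ε) * (δ i) ^ ((d : ℝ) - ε))

/-- The class of sets over which the supremum is taken: compact subsets of `ℝ^d`, of Hausdorff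
dimension `α`, that are `{δ_i}`-discrete `α`-regular for some sequence `δ_i → 0`. -/
structure IsAdmissible {d : ℕ} (α : ℝ) (E : Set (EuclideanSpace ℝ (Fin d))) : Prop where
  isCompact : IsCompact E
  dimH_eq : dimH E = ENNReal.ofReal α
  regular : IsDiscreteRegular E α

/-- The set `VS^k_t(E)` of `k`-chains `(x_0, …, x_k)` of pairwise distinct points of `E` with
prescribed gaps `|x_i - x_{i+1}| = t_i`.  It lives in the `(k+1)`-fold product of `ℝ^d`, whose
product metric is bi-Lipschitz equivalent to the Euclidean metric of `ℝ^{(k+1)d}`, so that Hausdorff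
and Minkowski dimensions are the same for both. -/
def chainSet {d k : ℕ} (t : Fin k → ℝ) (E : Set (EuclideanSpace ℝ (Fin d))) :
    Set (Fin (k + 1) → EuclideanSpace ℝ (Fin d)) :=
  {x | (∀ j, x j ∈ E) ∧ (∀ i : Fin k, dist (x i.castSucc) (x i.succ) = t i) ∧
    Function.Injective x}

/-- `g_d(VS^k_t, α)`: the supremum of the Hausdorff dimensions of the chain sets `VS^k_t(E)` over
all admissible `E ⊆ ℝ^d`. -/
def chainDimSup (d : ℕ) {k : ℕ} (t : Fin k → ℝ) (α : ℝ) : ℝ≥0∞ :=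
  ⨆ (E : Set (EuclideanSpace ℝ (Fin d))) (_ : IsAdmissible α E), dimH (chainSet t E)

/-- The lower Minkowski (lower box) dimension `liminf_{r → 0+} log N(A, r) / log (1 / r)`, where
`N(A, r)` is the least number of closed balls of radius `r` that cover `A`
(with value `⊥ = -∞` for the empty set). -/
def lowerMinkowskiDim {X : Type*} [PseudoEMetricSpace X] (A : Set X) : EReal :=
  liminf (fun r : ℝ≥0 =>
    ENNReal.log ((Metric.externalCoveringNumber r A : ℕ∞) : ℝ≥0∞) /
      ((Real.log (1 / (r : ℝ)) : ℝ) : EReal)) (𝓝[>] 0)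

end

/-! ### Plancherel and Parseval for integrals that converge absolutely. -/

section Fourier
open scoped FourierTransform RealInnerProductSpace
open SchwartzMap

variable {V : Type*} [NormedAddCommGroup V] [InnerProductSpace ℝ V] [FiniteDimensional ℝ V]
  [MeasurableSpace V] [BorelSpace V]

/-! Write `d = n + 1`. For the upper bounds, the `δ`-neighbourhood of the chain set lies in the set
of tuples of points of `A = E_δ` whose consecutive differences lie in shells of radius `t_i` and
width `4δ`. The volume of this set is obtained by iterating `k` convolution operators restricted to
`A`, so it is at most `N^k |A|`, where `N` bounds their norms on `L²(A)` (`volume_diffChains_le`).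

To bound `N`, the operator is paired with a second function supported in `A` and the pairing is
moved to the Fourier side. The transform of a shell is `O(δ min(1, |ξ|^(-(d-1)/2)))`
(`exists_norm_fourier_shell_le`). For `f` supported in `A`, the energy of its transform in `|ξ| ≤
1/(6r)` is at most `4 sup_x |A ∩ B(x,r)| / |B(0,r)|` times `‖f‖²`
(`lintegral_fourier_closedBall_le`). With discrete regularity, the dyadic scale `r ∈ [δ, 1]`
contributes about `δ^(d+1-α) r^(α-(d+1)/2)`, up to `ε` losses. The exponent of `r` changes sign at
`α = (d+1)/2`: above it `N` is about `δ^(d+1-α)`, and below it a factor `δ^(-γ)` with `γ = (d+1)/2 -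
α` is lost. As `|A|` is about `δ^(d-α)`, both Minkowski and Hausdorff dimensions are at most `(k+1)α
- k + kγ` (`dimension_chainSet_le`).

For sharpness, take `E = [0, L] × K^n` with `K` a Cantor set of dimension `(α-1)/n` and diameter
small compared with the gaps. All coordinates of the vertices in the Cantor directions, and the
first coordinate of the first vertex, can be chosen freely; the interval direction then supplies the
remaining first coordinates by Pythagoras. Hence the chain set has a Lipschitz image containing
`[0,1] × K^(n(k+1))`, of dimension `(k+1)α - k` (`exists_isAdmissible_le_dimH_chainSet`). -/

theorem continuous_fourier_of_integrable {f : V → ℂ} (hf : Integrable f) : Continuous (𝓕 f) :=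
  VectorFourier.fourierIntegral_continuous
    Real.continuous_fourierChar (by exact continuous_inner) hf

theorem integral_schwartz_fourier_smul {f : V → ℂ} (hf : Integrable f) (φ : 𝓢(V, ℂ)) :
    ∫ x, (𝓕 φ) x • f x = ∫ x, φ x • 𝓕 f x := by
  have := VectorFourier.integral_fourierIntegral_smul_eq_flip (L := innerₗ V) (μ := volume)
    (ν := volume) Real.continuous_fourierChar (by exact continuous_inner) φ.integrable hf
  rw [flip_innerₗ] at this
  exact this

theorem exists_schwartz_eq_ofReal {ψ : V → ℝ} (hψ : ContDiff ℝ ((⊤ : ℕ∞) : WithTop ℕ∞) ψ)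
    (hψc : HasCompactSupport ψ) : ∃ φ : 𝓢(V, ℂ), ∀ x, φ x = (ψ x : ℂ) := by
  have hψc' : HasCompactSupport (Complex.ofRealCLM ∘ ψ) := hψc.comp_left (by simp)
  refine ⟨hψc'.toSchwartzMap (Complex.ofRealCLM.contDiff.comp hψ), fun x => ?_⟩
  rw [HasCompactSupport.toSchwartzMap_toFun]
  simp

/-- The `L²` Fourier transform of an integrable function is given by the Fourier integral. -/
theorem fourier_Lp_ae_eq {f : V → ℂ} (hf : Integrable f) (g : Lp (α := V) ℂ 2 volume)
    (hg : g =ᵐ[volume] f) : (𝓕 g : Lp (α := V) ℂ 2 volume) =ᵐ[volume] 𝓕 f := by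
  -- Both sides are tested against smooth compactly supported functions. On the `L²` side the
  -- transform moves to the test function by its compatibility with tempered distributions, on the
  -- `L¹` side by Fubini.
  refine ae_eq_of_integral_contDiff_smul_eq ((Lp.memLp _).locallyIntegrable (by norm_num))
    (continuous_fourier_of_integrable hf).locallyIntegrable ?_
  intro ψ hψ hψc
  obtain ⟨φ, hφ⟩ := exists_schwartz_eq_ofReal (V := V) hψ hψc
  have h1 := congrArg (fun T => T φ) (Lp.fourier_toTemperedDistribution_eq g)
  rw [TemperedDistribution.fourier_apply, Lp.toTemperedDistribution_apply,
    Lp.toTemperedDistribution_apply] at h1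
  have h2 : ∫ x, (𝓕 φ) x • g x = ∫ x, (𝓕 φ) x • f x := by
    refine integral_congr_ae ?_
    filter_upwards [hg] with x hx
    rw [hx]
  rw [h2, integral_schwartz_fourier_smul hf] at h1
  simpa [hφ] using h1.symm

theorem inner_toLp_two {f g : V → ℂ}
    (F G : Lp (α := V) ℂ 2 volume) (hF : F =ᵐ[volume] f) (hG : G =ᵐ[volume] g) :
    inner ℂ F G = ∫ x, g x * starRingEnd ℂ (f x) := by
  rw [L2.inner_def]
  refine integral_congr_ae ?_
  filter_upwards [hF, hG] with x h1 h2
  rw [h1, h2]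
  rfl

theorem integral_mul_conj_fourier {f g : V → ℂ} (hf : Integrable f) (hf2 : MemLp f 2 volume)
    (hg : Integrable g) (hg2 : MemLp g 2 volume) :
    ∫ ξ, 𝓕 g ξ * starRingEnd ℂ (𝓕 f ξ) = ∫ x, g x * starRingEnd ℂ (f x) := by
  rw [← inner_toLp_two _ _ hf2.coeFn_toLp hg2.coeFn_toLp,
    ← inner_toLp_two _ _
      (fourier_Lp_ae_eq hf _ hf2.coeFn_toLp) (fourier_Lp_ae_eq hg _ hg2.coeFn_toLp),
    Lp.inner_fourier_eq]

theorem eLpNorm_two_sq {X : Type*} [MeasurableSpace X] {μ : Measure X} (f : X → ℂ) :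
    eLpNorm f 2 μ ^ 2 = ∫⁻ x, ‖f x‖ₑ ^ 2 ∂μ := by
  have := eLpNorm_nnreal_pow_eq_lintegral (f := f) (μ := μ) (p := 2) (by norm_num)
  simpa using this

/-- Plancherel's identity for functions in `L¹ ∩ L²`. -/
theorem lintegral_fourier_sq {f : V → ℂ} (hf : Integrable f) (hf2 : MemLp f 2 volume) :
    ∫⁻ ξ, ‖𝓕 f ξ‖ₑ ^ 2 = ∫⁻ x, ‖f x‖ₑ ^ 2 := by
  rw [← eLpNorm_two_sq, ← eLpNorm_two_sq,
    ← eLpNorm_congr_ae (fourier_Lp_ae_eq hf _ hf2.coeFn_toLp),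
    ← eLpNorm_congr_ae hf2.coeFn_toLp, ← Lp.enorm_def, ← Lp.enorm_def,
    ← ofReal_norm, ← ofReal_norm, Lp.norm_fourier_eq]

/-- The Cauchy-Schwarz inequality for the lower Lebesgue integral. -/
theorem lintegral_mul_sq_le {X : Type*} [MeasurableSpace X] {μ : Measure X} {f g : X → ℝ≥0∞}
    (hf : AEMeasurable f μ) (hg : AEMeasurable g μ) :
    (∫⁻ x, f x * g x ∂μ) ^ 2 ≤ (∫⁻ x, f x ^ 2 ∂μ) * ∫⁻ x, g x ^ 2 ∂μ := by
  have h := ENNReal.lintegral_mul_le_Lp_mul_Lq μ Real.HolderConjugate.two_two hf hg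
  simp only [Pi.mul_apply, ENNReal.rpow_two] at h
  calc (∫⁻ x, f x * g x ∂μ) ^ 2
      ≤ ((∫⁻ x, f x ^ 2 ∂μ) ^ (1 / (2 : ℝ)) * (∫⁻ x, g x ^ 2 ∂μ) ^ (1 / (2 : ℝ))) ^ 2 := by gcongr
    _ = _ := by
      rw [mul_pow, ← ENNReal.rpow_natCast, ← ENNReal.rpow_natCast, ← ENNReal.rpow_mul,
        ← ENNReal.rpow_mul]
      norm_num

-- The convolution is both integrable and bounded, hence square integrable; this makes Plancherel
-- available for it.
open scoped Convolution in
theorem memLp_two_convolution {K f : V → ℂ} (hK : Integrable K) {M : ℝ} (hKM : ∀ x, ‖K x‖ ≤ M)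
    (hf : Integrable f) :
    Integrable (K ⋆[ContinuousLinearMap.mul ℂ ℂ] f) ∧
      MemLp (K ⋆[ContinuousLinearMap.mul ℂ ℂ] f) 2 volume := by
  have h1 := hK.integrable_convolution (ContinuousLinearMap.mul ℂ ℂ) hf
  refine ⟨h1, ?_⟩
  have hb : ∀ x, ‖(K ⋆[ContinuousLinearMap.mul ℂ ℂ] f) x‖ ≤ M * ∫ y, ‖f y‖ := by
    intro x
    rw [convolution_def]
    have h2 : ∫ y, ‖f (x - y)‖ = ∫ y, ‖f y‖ := integral_sub_left_eq_self (fun y => ‖f y‖) volume x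
    rw [← h2, ← integral_const_mul]
    refine (norm_integral_le_integral_norm _).trans ?_
    have h3 : Integrable (fun y => M * ‖f (x - y)‖) := (hf.comp_sub_left x).norm.const_mul M
    refine integral_mono_of_nonneg (ae_of_all _ fun _ => norm_nonneg _) h3
      (ae_of_all _ fun y => ?_)
    simp only [ContinuousLinearMap.mul_apply', norm_mul]
    gcongr
    exact hKM y
  refine (memLp_two_iff_integrable_sq_norm h1.1).2 ?_
  refine (h1.norm.const_mul (M * ∫ y, ‖f y‖)).mono' (h1.1.norm.pow 2) (ae_of_all _ fun x => ?_)
  rw [Real.norm_of_nonneg (by positivity), sq]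
  gcongr
  exact hb x
end Fourier

/-! ### Localised `L²` restriction estimates for functions supported in a set. -/

section LocalFourier
open scoped FourierTransform RealInnerProductSpace Convolution

variable {V : Type*} [NormedAddCommGroup V] [InnerProductSpace ℝ V] [FiniteDimensional ℝ V]
  [MeasurableSpace V] [BorelSpace V]

theorem integrable_indicator_one {s : Set V} (hs : MeasurableSet s) (hb : Bornology.IsBounded s) :
    Integrable (s.indicator (fun _ => (1 : ℂ))) :=
  (integrable_indicator_iff hs).2 (integrableOn_const hb.measure_lt_top.ne)

theorem fourier_indicator_re {s : Set V} (hs : MeasurableSet s) (hb : Bornology.IsBounded s)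
    (ξ : V) : (𝓕 (s.indicator (fun _ => (1 : ℂ))) ξ).re = ∫ v in s, Real.cos (2 * Real.pi * ⟪v, ξ⟫) := by
  have hint : Integrable (fun v => Real.fourierChar (-⟪v, ξ⟫) • s.indicator (fun _ => (1 : ℂ)) v) :=
    (Real.fourierIntegral_convergent_iff ξ).2 (integrable_indicator_one hs hb)
  rw [Real.fourier_eq, ← RCLike.re_eq_complex_re, ← integral_re hint, ← integral_indicator hs]
  congr 1
  ext v
  by_cases hv : v ∈ s
  · simp [hv, Circle.smul_def, Real.fourierChar_apply, Complex.exp_re]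
  · simp [hv]

/-- On the dual ball the phase `2π⟪v, ξ⟫` has absolute value at most `π/3`, so the cosine is at
least `1/2` throughout the ball. This fixes the radius `1/(6r)` used from here on. -/
theorem half_volume_le_norm_fourier_closedBall {r : ℝ} (hr : 0 < r) {ξ : V}
    (hξ : ‖ξ‖ ≤ 1 / (6 * r)) :
    volume.real (Metric.closedBall (0 : V) r) / 2 ≤
      ‖𝓕 ((Metric.closedBall (0 : V) r).indicator (fun _ => (1 : ℂ))) ξ‖ := by
  refine le_trans ?_ (Complex.re_le_norm _)
  rw [fourier_indicator_re Metric.isClosed_closedBall.measurableSet Metric.isBounded_closedBall]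
  have hfin : volume (Metric.closedBall (0 : V) r) ≠ ∞ := Metric.isBounded_closedBall.measure_lt_top.ne
  have h1 : ∫ _v in Metric.closedBall (0 : V) r, (1 / 2 : ℝ) =
      volume.real (Metric.closedBall (0 : V) r) / 2 := by
    rw [setIntegral_const, smul_eq_mul]; ring
  rw [← h1]
  refine setIntegral_mono_on (integrableOn_const hfin) ?_
    Metric.isClosed_closedBall.measurableSet fun v hv => ?_
  · exact ContinuousOn.integrableOn_compact (isCompact_closedBall _ _)
      (Continuous.continuousOn (by fun_prop))
  · have hv' : ‖v‖ ≤ r := by simpa using hv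
    have h2 : |⟪v, ξ⟫| ≤ 1 / 6 := by
      calc |⟪v, ξ⟫| ≤ ‖v‖ * ‖ξ‖ := abs_real_inner_le_norm v ξ
        _ ≤ r * (1 / (6 * r)) := by gcongr
        _ = 1 / 6 := by field_simp
    rw [← Real.cos_pi_div_three, ← Real.cos_abs (2 * Real.pi * _), abs_mul,
      abs_of_pos Real.two_pi_pos]
    refine Real.cos_le_cos_of_nonneg_of_le_pi (by positivity) (by linarith [Real.pi_pos]) ?_
    nlinarith [Real.pi_pos]

/-- Convolution with the indicator of a ball is bounded on functions supported in `A` by the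
volumes of the pieces of `A` in balls of the same radius. -/
theorem lintegral_ball_convolution_sq_le {A : Set V} (hA : MeasurableSet A) {r : ℝ} {S : ℝ≥0∞}
    (hS : ∀ x, volume (A ∩ Metric.closedBall x r) ≤ S) {f : V → ℂ}
    (hf : AEMeasurable f) (hfA : ∀ x, x ∉ A → f x = 0) :
    ∫⁻ x, ‖((Metric.closedBall (0 : V) r).indicator (fun _ => (1 : ℂ))
        ⋆[ContinuousLinearMap.mul ℂ ℂ] f) x‖ₑ ^ 2 ≤
      S * volume (Metric.closedBall (0 : V) r) * ∫⁻ x, ‖f x‖ₑ ^ 2 := by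
  have hfe : AEMeasurable (fun x => ‖f x‖ₑ) := hf.enorm
  have hset : MeasurableSet {p : V × V | dist p.2 p.1 ≤ r} :=
    (isClosed_le (by fun_prop) continuous_const).measurableSet
  have hmeas : AEMeasurable (Function.uncurry fun x y : V =>
      (Metric.closedBall x r).indicator (fun y => ‖f y‖ₑ ^ 2) y) (volume.prod volume) := by
    have := ((hfe.pow_const 2).comp_snd (μ := volume)).indicator hset
    exact this
  have h1 : ∀ x, ‖((Metric.closedBall (0 : V) r).indicator (fun _ => (1 : ℂ))
      ⋆[ContinuousLinearMap.mul ℂ ℂ] f) x‖ₑ ^ 2 ≤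
        S * ∫⁻ y, (Metric.closedBall x r).indicator (fun y => ‖f y‖ₑ ^ 2) y := by
    intro x
    rw [convolution_eq_swap]
    have hB : MeasurableSet (A ∩ Metric.closedBall x r) :=
      hA.inter Metric.isClosed_closedBall.measurableSet
    have h2 : ‖∫ t, (ContinuousLinearMap.mul ℂ ℂ)
        ((Metric.closedBall (0 : V) r).indicator (fun _ => (1 : ℂ)) (x - t)) (f t)‖ₑ ≤
        ∫⁻ y, (A ∩ Metric.closedBall x r).indicator 1 y * ‖f y‖ₑ := by
      refine (enorm_integral_le_lintegral_enorm _).trans (lintegral_mono fun y => ?_)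
      by_cases hyA : y ∈ A
      · by_cases hy : dist y x ≤ r
        · simp [hyA, hy, Set.indicator]
          split_ifs <;> simp
        · have : ¬ ‖x - y‖ ≤ r := by rwa [← dist_eq_norm, dist_comm]
          simp [hyA, hy, this, Set.indicator]
      · simp [hfA y hyA]
    -- Cauchy-Schwarz against the indicator of `A ∩ B(x, r)`: the support of `f` is what replaces
    -- the full volume of the ball by `S`.
    calc _ ≤ (∫⁻ y, (A ∩ Metric.closedBall x r).indicator 1 y *
          ((Metric.closedBall x r).indicator (fun y => ‖f y‖ₑ) y)) ^ 2 := by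
            gcongr
            refine h2.trans (lintegral_mono fun y => ?_)
            by_cases hy : y ∈ A ∩ Metric.closedBall x r
            · simp [hy.1, Set.indicator, Metric.mem_closedBall.1 hy.2]
            · simp [hy]
      _ ≤ (∫⁻ y, (A ∩ Metric.closedBall x r).indicator 1 y ^ 2) *
          ∫⁻ y, ((Metric.closedBall x r).indicator (fun y => ‖f y‖ₑ) y) ^ 2 :=
          lintegral_mul_sq_le (aemeasurable_one.indicator hB)
            (hfe.indicator Metric.isClosed_closedBall.measurableSet)
      _ ≤ _ := by
          gcongr
          · refine le_trans (le_of_eq ?_) (hS x)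
            rw [← lintegral_indicator_one hB]
            congr 1; ext y
            by_cases hy : y ∈ A ∩ Metric.closedBall x r <;> simp [hy]
          · rename_i y
            by_cases hy : y ∈ Metric.closedBall x r
            · rw [indicator_of_mem hy, indicator_of_mem hy]
            · rw [indicator_of_notMem hy, indicator_of_notMem hy]; simp
  calc _ ≤ ∫⁻ x, S * ∫⁻ y, (Metric.closedBall x r).indicator (fun y => ‖f y‖ₑ ^ 2) y :=
        lintegral_mono h1
    _ = S * ∫⁻ x, ∫⁻ y, (Metric.closedBall x r).indicator (fun y => ‖f y‖ₑ ^ 2) y := by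
        exact lintegral_const_mul'' _ hmeas.lintegral_prod_right'
    _ = S * ∫⁻ y, ∫⁻ x, (Metric.closedBall x r).indicator (fun y => ‖f y‖ₑ ^ 2) y := by
        rw [lintegral_lintegral_swap hmeas]
    _ = S * ∫⁻ y, volume (Metric.closedBall (0 : V) r) * ‖f y‖ₑ ^ 2 := by
        -- After Fubini, the symmetry of `y ∈ B(x, r)` in `x` and `y` turns the inner integral into
        -- the volume of a ball.
        congr 2; ext y
        have : ∀ x, (Metric.closedBall x r).indicator (fun y => ‖f y‖ₑ ^ 2) y =
            (Metric.closedBall y r).indicator (fun _ => ‖f y‖ₑ ^ 2) x := by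
          intro x
          simp only [Set.indicator, Metric.mem_closedBall, dist_comm x y]
        simp_rw [this]
        rw [lintegral_indicator Metric.isClosed_closedBall.measurableSet, setLIntegral_const,
          mul_comm, ← Measure.addHaar_closedBall_center volume y]
    _ = _ := by
        rw [lintegral_const_mul'' _ (hfe.pow_const 2), mul_assoc]

theorem inv_half_sq_mul_self {v : ℝ≥0∞} (hv0 : v ≠ 0) (hvt : v ≠ ∞) :
    ((v / 2) ^ 2)⁻¹ * v = 4 / v := by
  have h2 : (v / 2) ^ 2 ≠ 0 := by simp [ENNReal.div_eq_zero_iff, hv0]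
  rw [← ENNReal.toReal_eq_toReal_iff' (by finiteness) (by finiteness)]
  have h3 : v.toReal ≠ 0 := ENNReal.toReal_ne_zero.2 ⟨hv0, hvt⟩
  simp only [ENNReal.toReal_mul, ENNReal.toReal_inv, ENNReal.toReal_pow, ENNReal.toReal_div]
  simp only [ENNReal.toReal_ofNat]
  field_simp
  norm_num

/-- The transform of the indicator of `B(0, r)` has modulus at least `|B(0, r)|/2` on the dual ball.
So the low-frequency energy of `f` is controlled by the `L²` norm of the convolution of `f` with
that indicator, which sees only the pieces of `A` in balls of radius `r`. -/
theorem lintegral_fourier_closedBall_le {A : Set V} (hA : MeasurableSet A) {r : ℝ} (hr : 0 < r)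
    {S : ℝ≥0∞} (hS : ∀ x, volume (A ∩ Metric.closedBall x r) ≤ S) {f : V → ℂ} (hf : Integrable f)
    (hfA : ∀ x, x ∉ A → f x = 0) :
    ∫⁻ ξ in Metric.closedBall (0 : V) (1 / (6 * r)), ‖𝓕 f ξ‖ₑ ^ 2 ≤
      4 * S / volume (Metric.closedBall (0 : V) r) * ∫⁻ x, ‖f x‖ₑ ^ 2 := by
  set B : V → ℂ := (Metric.closedBall (0 : V) r).indicator (fun _ => (1 : ℂ)) with hBdef
  set v := volume (Metric.closedBall (0 : V) r) with hv
  have hBm : MeasurableSet (Metric.closedBall (0 : V) r) := Metric.isClosed_closedBall.measurableSet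
  have hB : Integrable B := integrable_indicator_one hBm Metric.isBounded_closedBall
  have hBb : ∀ x, ‖B x‖ ≤ 1 := by
    intro x
    by_cases hx : x ∈ Metric.closedBall (0 : V) r
    · simp [hBdef, indicator_of_mem hx]
    · simp [hBdef, indicator_of_notMem hx]
  obtain ⟨hc1, hc2⟩ := memLp_two_convolution hB hBb hf
  have hv0 : v ≠ 0 := (Metric.measure_closedBall_pos volume _ hr).ne'
  have hvt : v ≠ ∞ := Metric.isBounded_closedBall.measure_lt_top.ne
  have key : ∫⁻ ξ in Metric.closedBall (0 : V) (1 / (6 * r)), (v / 2) ^ 2 * ‖𝓕 f ξ‖ₑ ^ 2 ≤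
      S * v * ∫⁻ x, ‖f x‖ₑ ^ 2 := by
    refine le_trans ?_ (lintegral_ball_convolution_sq_le hA hS hf.aestronglyMeasurable.aemeasurable
      hfA)
    rw [← lintegral_fourier_sq hc1 hc2]
    refine le_trans ?_ (setLIntegral_le_lintegral (Metric.closedBall (0 : V) (1 / (6 * r))) _)
    refine setLIntegral_mono' Metric.isClosed_closedBall.measurableSet fun ξ hξ => ?_
    rw [Real.fourier_mul_convolution_eq hB hf, enorm_mul, mul_pow]
    gcongr
    have := half_volume_le_norm_fourier_closedBall (V := V) hr (ξ := ξ) (by simpa using hξ)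
    have h2 := ENNReal.ofReal_le_ofReal this
    rw [ofReal_norm, ENNReal.ofReal_div_of_pos (by norm_num), Measure.real,
      ENNReal.ofReal_toReal hvt] at h2
    simpa using h2
  rw [lintegral_const_mul' _ _ (by finiteness)] at key
  have hv2 : (v / 2) ^ 2 ≠ 0 := by simp [ENNReal.div_eq_zero_iff, hv0]
  have hv3 : (v / 2) ^ 2 ≠ ∞ := by finiteness
  calc _ = ((v / 2) ^ 2)⁻¹ * ((v / 2) ^ 2 *
        ∫⁻ ξ in Metric.closedBall (0 : V) (1 / (6 * r)), ‖𝓕 f ξ‖ₑ ^ 2) := by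
        rw [← mul_assoc, ENNReal.inv_mul_cancel hv2 hv3, one_mul]
    _ ≤ ((v / 2) ^ 2)⁻¹ * (S * v * ∫⁻ x, ‖f x‖ₑ ^ 2) := by gcongr
    _ = (((v / 2) ^ 2)⁻¹ * v) * S * ∫⁻ x, ‖f x‖ₑ ^ 2 := by ring
    _ = _ := by
      congr 1
      rw [inv_half_sq_mul_self hv0 hvt, ENNReal.div_eq_inv_mul, ENNReal.div_eq_inv_mul]
      ring

theorem lintegral_mul_fourier_closedBall_le {A : Set V} (hA : MeasurableSet A) {r : ℝ} (hr : 0 < r)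
    {S : ℝ≥0∞} (hS : ∀ x, volume (A ∩ Metric.closedBall x r) ≤ S) {f g : V → ℂ}
    (hf : Integrable f) (hfA : ∀ x, x ∉ A → f x = 0) (hg : Integrable g)
    (hgA : ∀ x, x ∉ A → g x = 0) :
    ∫⁻ ξ in Metric.closedBall (0 : V) (1 / (6 * r)), ‖𝓕 f ξ‖ₑ * ‖𝓕 g ξ‖ₑ ≤
      4 * S / volume (Metric.closedBall (0 : V) r) *
        ((∫⁻ x, ‖f x‖ₑ ^ 2) * ∫⁻ x, ‖g x‖ₑ ^ 2) ^ (1 / 2 : ℝ) := by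
  have hfm : Measurable (fun ξ => ‖𝓕 f ξ‖ₑ) :=
    (continuous_fourier_of_integrable hf).measurable.enorm
  have hgm : Measurable (fun ξ => ‖𝓕 g ξ‖ₑ) :=
    (continuous_fourier_of_integrable hg).measurable.enorm
  rw [← ENNReal.pow_le_pow_left_iff two_ne_zero, mul_pow, ← ENNReal.rpow_natCast (_ ^ _),
    ← ENNReal.rpow_mul]
  calc _ ≤ _ := lintegral_mul_sq_le hfm.aemeasurable hgm.aemeasurable
    _ ≤ _ := mul_le_mul' (lintegral_fourier_closedBall_le hA hr hS hf hfA)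
      (lintegral_fourier_closedBall_le hA hr hS hg hgA)
    _ = _ := by norm_num; ring

/-- A convolution operator whose symbol is dominated by a combination of indicators of balls is
bounded on `L²(A)`, in terms of the volumes of the pieces of `A` in the dual balls. -/
theorem lintegral_convolution_sq_le {A : Set V} (hA : MeasurableSet A) {n : ℕ} {r : ℕ → ℝ}
    (hr : ∀ j, 0 < r j) {S a : ℕ → ℝ≥0∞} {b : ℝ≥0∞}
    (hS : ∀ j ∈ Finset.range n, ∀ x, volume (A ∩ Metric.closedBall x (r j)) ≤ S j)
    {K : V → ℂ} (hK : Integrable K) {M : ℝ} (hKM : ∀ x, ‖K x‖ ≤ M)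
    (hKa : ∀ ξ, ‖𝓕 K ξ‖ₑ ≤ ∑ j ∈ Finset.range n,
      (Metric.closedBall (0 : V) (1 / (6 * r j))).indicator (fun _ => a j) ξ + b)
    {f : V → ℂ} (hf : Integrable f) (hf2 : MemLp f 2 volume) (hfA : ∀ x, x ∉ A → f x = 0) :
    ∫⁻ x in A, ‖(K ⋆[ContinuousLinearMap.mul ℂ ℂ] f) x‖ₑ ^ 2 ≤
      (∑ j ∈ Finset.range n, a j * (4 * S j / volume (Metric.closedBall (0 : V) (r j))) + b) ^ 2 *
        ∫⁻ x, ‖f x‖ₑ ^ 2 := by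
  obtain ⟨hc1, hc2⟩ := memLp_two_convolution hK hKM hf
  set u := K ⋆[ContinuousLinearMap.mul ℂ ℂ] f with hu
  set g := A.indicator u with hg
  have hg1 : Integrable g := hc1.indicator hA
  have hg2 : MemLp g 2 volume := hc2.indicator hA
  have hgA : ∀ x, x ∉ A → g x = 0 := fun x hx => indicator_of_notMem hx _
  set F := ∫⁻ x, ‖f x‖ₑ ^ 2 with hF
  set X := ∫⁻ x, ‖g x‖ₑ ^ 2 with hX
  have hXt : X ≠ ∞ := by
    rw [hX, ← eLpNorm_two_sq]
    exact ENNReal.pow_ne_top hg2.2.ne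
  have hXA : ∫⁻ x in A, ‖u x‖ₑ ^ 2 = X := by
    rw [hX, ← lintegral_indicator hA]
    congr 1; ext x
    by_cases hx : x ∈ A <;> simp [hg, hx]
  have hfm : Measurable (fun ξ => ‖𝓕 f ξ‖ₑ) :=
    (continuous_fourier_of_integrable hf).measurable.enorm
  have hgm : Measurable (fun ξ => ‖𝓕 g ξ‖ₑ) :=
    (continuous_fourier_of_integrable hg1).measurable.enorm
  -- Duality: `X` is the pairing of `K ⋆ f` with its own restriction `g` to `A`. Since `g` is again
  -- supported in `A`, the local estimate applies to both factors after Parseval.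
  have h1 : X ≤ ∫⁻ ξ, ‖𝓕 K ξ‖ₑ * (‖𝓕 f ξ‖ₑ * ‖𝓕 g ξ‖ₑ) := by
    have hpars := integral_mul_conj_fourier hg1 hg2 hc1 hc2
    have h2 : ∫ x, u x * starRingEnd ℂ (g x) = ((∫ x, ‖g x‖ ^ 2 : ℝ) : ℂ) := by
      rw [← integral_complex_ofReal]
      congr 1; ext x
      by_cases hx : x ∈ A
      · simp [hg, hx, Complex.mul_conj, Complex.normSq_eq_norm_sq]
      · simp [hg, hx]
    have h3 : X = ENNReal.ofReal (∫ x, ‖g x‖ ^ 2) := by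
      rw [ofReal_integral_eq_lintegral_ofReal ((memLp_two_iff_integrable_sq_norm hg2.1).1 hg2)
        (ae_of_all _ fun x => by positivity)]
      refine lintegral_congr fun x => ?_
      rw [ENNReal.ofReal_pow (norm_nonneg _), ofReal_norm]
    have h4 : X = ‖∫ x, u x * starRingEnd ℂ (g x)‖ₑ := by
      rw [h2, h3, ← ofReal_norm, Complex.norm_real, Real.norm_of_nonneg]
      positivity
    rw [h4, ← hpars]
    refine (enorm_integral_le_lintegral_enorm _).trans (lintegral_mono fun ξ => ?_)
    rw [hu, Real.fourier_mul_convolution_eq hK hf, enorm_mul, enorm_mul, mul_assoc]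
    simp
  have h2 : ∫⁻ ξ, ‖𝓕 K ξ‖ₑ * (‖𝓕 f ξ‖ₑ * ‖𝓕 g ξ‖ₑ) ≤
      (∑ j ∈ Finset.range n, a j * (4 * S j / volume (Metric.closedBall (0 : V) (r j))) + b) *
        (F * X) ^ (1 / 2 : ℝ) := by
    calc _ ≤ ∫⁻ ξ, (∑ j ∈ Finset.range n,
          (Metric.closedBall (0 : V) (1 / (6 * r j))).indicator
            (fun ξ => a j * (‖𝓕 f ξ‖ₑ * ‖𝓕 g ξ‖ₑ)) ξ + b * (‖𝓕 f ξ‖ₑ * ‖𝓕 g ξ‖ₑ)) := by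
          refine lintegral_mono fun ξ => ?_
          calc _ ≤ _ := mul_le_mul_left (hKa ξ) _
            _ = _ := by
              rw [add_mul, Finset.sum_mul]
              congr 1
              refine Finset.sum_congr rfl fun j _ => ?_
              by_cases hξ : ξ ∈ Metric.closedBall (0 : V) (1 / (6 * r j))
              · rw [indicator_of_mem hξ, indicator_of_mem hξ]
              · rw [indicator_of_notMem hξ, indicator_of_notMem hξ, zero_mul]
      _ = ∑ j ∈ Finset.range n, a j * (∫⁻ ξ in Metric.closedBall (0 : V) (1 / (6 * r j)),
            (‖𝓕 f ξ‖ₑ * ‖𝓕 g ξ‖ₑ)) + b * ∫⁻ ξ, ‖𝓕 f ξ‖ₑ * ‖𝓕 g ξ‖ₑ := by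
          rw [lintegral_add_right _ (by fun_prop), lintegral_const_mul _ (by fun_prop),
            lintegral_finsetSum _ fun j _ => Measurable.indicator (by fun_prop)
              Metric.isClosed_closedBall.measurableSet]
          congr 1
          refine Finset.sum_congr rfl fun j _ => ?_
          rw [lintegral_indicator Metric.isClosed_closedBall.measurableSet,
            lintegral_const_mul _ (by fun_prop)]
      _ ≤ _ := by
          rw [add_mul, Finset.sum_mul]
          refine add_le_add (Finset.sum_le_sum fun j hj => ?_) (mul_le_mul_right ?_ b)
          · rw [mul_assoc]
            exact mul_le_mul_right (lintegral_mul_fourier_closedBall_le hA (hr j) (hS j hj)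
              hf hfA hg1 hgA) _
          -- The constant part `b` of the symbol needs no localisation, only Plancherel for both
          -- functions.
          · rw [← ENNReal.pow_le_pow_left_iff two_ne_zero, ← ENNReal.rpow_natCast (_ ^ _),
              ← ENNReal.rpow_mul]
            refine (lintegral_mul_sq_le hfm.aemeasurable hgm.aemeasurable).trans ?_
            rw [lintegral_fourier_sq hf hf2, lintegral_fourier_sq hg1 hg2]
            norm_num
            exact le_rfl
  rw [hXA]
  set N := ∑ j ∈ Finset.range n, a j * (4 * S j / volume (Metric.closedBall (0 : V) (r j))) + b
  by_cases hX0 : X = 0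
  · rw [hX0]; exact zero_le
  -- Squaring `X ≤ N (F X)^(1/2)` leaves one factor `X` to cancel, which is legitimate as `X` is
  -- finite and nonzero.
  have h3 : X * X ≤ (N ^ 2 * F) * X := by
    have h4 := pow_le_pow_left' (h1.trans h2) 2
    rw [mul_pow, ← ENNReal.rpow_natCast (_ ^ _), ← ENNReal.rpow_mul] at h4
    norm_num at h4
    rwa [← mul_assoc, sq X] at h4
  exact (ENNReal.mul_le_mul_iff_left hX0 hXt).1 h3

end LocalFourier

/-! ### Decay of Bessel functions through their differential equation. -/

section Bessel

/-- Poisson's integral for the Bessel functions, up to normalisation. -/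
noncomputable def poissonIntegral (p ρ : ℝ) : ℝ := ∫ s in (-1 : ℝ)..1, Real.cos (ρ * s) * (1 - s ^ 2) ^ p

noncomputable def poissonIntegralDeriv (p ρ : ℝ) : ℝ :=
  ∫ s in (-1 : ℝ)..1, -(s * Real.sin (ρ * s)) * (1 - s ^ 2) ^ p

noncomputable def poissonIntegralDeriv2 (p ρ : ℝ) : ℝ :=
  ∫ s in (-1 : ℝ)..1, -(s ^ 2 * Real.cos (ρ * s)) * (1 - s ^ 2) ^ p

variable {p : ℝ}

theorem continuous_one_sub_sq_rpow (hp : 0 ≤ p) : Continuous fun s : ℝ => (1 - s ^ 2) ^ p :=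
  (by fun_prop : Continuous fun s : ℝ => 1 - s ^ 2).rpow_const fun _ => Or.inr hp

theorem one_sub_sq_rpow_mem (hp : 0 ≤ p) {s : ℝ} (hs : s ∈ uIoc (-1 : ℝ) 1) :
    0 ≤ (1 - s ^ 2) ^ p ∧ (1 - s ^ 2) ^ p ≤ 1 ∧ |s| ≤ 1 := by
  rw [uIoc_of_le (by norm_num)] at hs
  have h1 : |s| ≤ 1 := abs_le.2 ⟨hs.1.le, hs.2⟩
  have h2 : s ^ 2 ≤ 1 := (sq_le_one_iff_abs_le_one s).2 h1
  exact ⟨Real.rpow_nonneg (by linarith) _,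
    Real.rpow_le_one (by linarith) (by nlinarith [sq_nonneg s]) hp, h1⟩

theorem hasDerivAt_poissonIntegral (hp : 0 ≤ p) (ρ : ℝ) :
    HasDerivAt (poissonIntegral p) (poissonIntegralDeriv p ρ) ρ := by
  have hc := continuous_one_sub_sq_rpow hp
  refine (intervalIntegral.hasDerivAt_integral_of_dominated_loc_of_deriv_le (bound := fun _ => 1)
    (F := fun ρ s => Real.cos (ρ * s) * (1 - s ^ 2) ^ p)
    (F' := fun ρ s => -(s * Real.sin (ρ * s)) * (1 - s ^ 2) ^ p) univ_mem
    (Eventually.of_forall fun x => Continuous.aestronglyMeasurable (by fun_prop))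
    (Continuous.intervalIntegrable (by fun_prop) _ _)
    (Continuous.aestronglyMeasurable (by fun_prop))
    (ae_of_all _ fun s hs x _ => ?_) intervalIntegrable_const
    (ae_of_all _ fun s hs x _ => ?_)).2
  · obtain ⟨h1, h2, h3⟩ := one_sub_sq_rpow_mem hp hs
    rw [Real.norm_eq_abs, abs_mul, abs_neg, abs_mul, abs_of_nonneg h1]
    exact mul_le_one₀ (mul_le_one₀ h3 (abs_nonneg _) (Real.abs_sin_le_one _)) h1 h2
  · exact ((((hasDerivAt_id x).mul_const s).cos).mul_const ((1 - s ^ 2) ^ p)).congr_deriv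
      (by simp only [id, one_mul]; ring)

theorem hasDerivAt_poissonIntegralDeriv (hp : 0 ≤ p) (ρ : ℝ) :
    HasDerivAt (poissonIntegralDeriv p) (poissonIntegralDeriv2 p ρ) ρ := by
  have hc := continuous_one_sub_sq_rpow hp
  refine (intervalIntegral.hasDerivAt_integral_of_dominated_loc_of_deriv_le (bound := fun _ => 1)
    (F := fun ρ s => -(s * Real.sin (ρ * s)) * (1 - s ^ 2) ^ p)
    (F' := fun ρ s => -(s ^ 2 * Real.cos (ρ * s)) * (1 - s ^ 2) ^ p) univ_mem
    (Eventually.of_forall fun x => Continuous.aestronglyMeasurable (by fun_prop))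
    (Continuous.intervalIntegrable (by fun_prop) _ _)
    (Continuous.aestronglyMeasurable (by fun_prop))
    (ae_of_all _ fun s hs x _ => ?_) intervalIntegrable_const
    (ae_of_all _ fun s hs x _ => ?_)).2
  · obtain ⟨h1, h2, h3⟩ := one_sub_sq_rpow_mem hp hs
    rw [Real.norm_eq_abs, abs_mul, abs_neg, abs_mul, abs_of_nonneg h1, abs_pow]
    exact mul_le_one₀ (mul_le_one₀ (pow_le_one₀ (abs_nonneg _) h3) (abs_nonneg _)
      (Real.abs_cos_le_one _)) h1 h2
  · exact ((((hasDerivAt_id x).mul_const s).sin.const_mul s).neg.mul_const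
      ((1 - s ^ 2) ^ p)).congr_deriv (by simp only [id, one_mul]; ring)

theorem abs_poissonIntegral_le (hp : 0 ≤ p) (ρ : ℝ) :
    |poissonIntegral p ρ| ≤ 2 ∧ |poissonIntegralDeriv p ρ| ≤ 2 := by
  constructor
  · rw [poissonIntegral, ← Real.norm_eq_abs]
    refine (intervalIntegral.norm_integral_le_of_norm_le_const (C := 1) fun s hs => ?_).trans
      (by norm_num [abs_of_nonneg])
    obtain ⟨h1, h2, h3⟩ := one_sub_sq_rpow_mem hp hs
    rw [Real.norm_eq_abs, abs_mul, abs_of_nonneg h1]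
    exact mul_le_one₀ (Real.abs_cos_le_one _) h1 h2
  · rw [poissonIntegralDeriv, ← Real.norm_eq_abs]
    refine (intervalIntegral.norm_integral_le_of_norm_le_const (C := 1) fun s hs => ?_).trans
      (by norm_num [abs_of_nonneg])
    obtain ⟨h1, h2, h3⟩ := one_sub_sq_rpow_mem hp hs
    rw [Real.norm_eq_abs, abs_mul, abs_neg, abs_mul, abs_of_nonneg h1]
    exact mul_le_one₀ (mul_le_one₀ h3 (abs_nonneg _) (Real.abs_sin_le_one _)) h1 h2

/-- Bessel's differential equation. -/
theorem poissonIntegral_ode (hp : 0 ≤ p) (ρ : ℝ) :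
    ρ * (poissonIntegralDeriv2 p ρ + poissonIntegral p ρ) =
      -(2 * (p + 1)) * poissonIntegralDeriv p ρ := by
  have hc := continuous_one_sub_sq_rpow hp
  have hc1 := continuous_one_sub_sq_rpow (p := p + 1) (by linarith)
  have h1 : poissonIntegralDeriv2 p ρ + poissonIntegral p ρ =
      ∫ s in (-1 : ℝ)..1, Real.cos (ρ * s) * (1 - s ^ 2) ^ (p + 1) := by
    rw [poissonIntegralDeriv2, poissonIntegral, ← intervalIntegral.integral_add
      (Continuous.intervalIntegrable (by fun_prop) _ _)
      (Continuous.intervalIntegrable (by fun_prop) _ _)]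
    refine intervalIntegral.integral_congr fun s hs => ?_
    rw [uIcc_of_le (by norm_num)] at hs
    have : (0 : ℝ) ≤ 1 - s ^ 2 := by nlinarith [hs.1, hs.2]
    rw [Real.rpow_add_one' this (by linarith)]
    ring
  -- Integration by parts against `(1 - s²)^(p+1)`, which vanishes at both endpoints and whose
  -- derivative reproduces the weight `(1 - s²)^p`.
  have h2 := intervalIntegral.integral_mul_deriv_eq_deriv_mul (a := -1) (b := 1)
    (u := fun s => Real.sin (ρ * s)) (v := fun s => (1 - s ^ 2) ^ (p + 1))
    (u' := fun s => Real.cos (ρ * s) * ρ)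
    (v' := fun s => -(2 * s) * (p + 1) * (1 - s ^ 2) ^ p)
    (fun s _ => (((hasDerivAt_id s).const_mul ρ).sin).congr_deriv (by simp))
    (fun s _ => by
      have h3 : HasDerivAt (fun s : ℝ => 1 - s ^ 2) (-(2 * s)) s := by
        simpa using (hasDerivAt_pow 2 s).const_sub 1
      have := h3.rpow_const (p := p + 1) (Or.inr (by linarith))
      simpa using this)
    (Continuous.intervalIntegrable (by fun_prop) _ _)
    (Continuous.intervalIntegrable (by fun_prop) _ _)
  have hz : ((1 : ℝ) - 1 ^ 2) ^ (p + 1) = 0 := by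
    norm_num; exact Real.zero_rpow (by linarith)
  have hz' : ((1 : ℝ) - (-1) ^ 2) ^ (p + 1) = 0 := by
    norm_num; exact Real.zero_rpow (by linarith)
  rw [hz, hz'] at h2
  have h4 : ∫ s in (-1 : ℝ)..1, Real.sin (ρ * s) * (-(2 * s) * (p + 1) * (1 - s ^ 2) ^ p) =
      2 * (p + 1) * poissonIntegralDeriv p ρ := by
    rw [poissonIntegralDeriv, ← intervalIntegral.integral_const_mul]
    refine intervalIntegral.integral_congr fun s _ => ?_
    ring
  have h5 : ∫ s in (-1 : ℝ)..1, Real.cos (ρ * s) * ρ * (1 - s ^ 2) ^ (p + 1) =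
      ρ * ∫ s in (-1 : ℝ)..1, Real.cos (ρ * s) * (1 - s ^ 2) ^ (p + 1) := by
    rw [← intervalIntegral.integral_const_mul]
    refine intervalIntegral.integral_congr fun s _ => ?_
    ring
  rw [h4, h5, ← h1] at h2
  linarith

/-- The decay of Bessel functions, proved by an energy estimate for Bessel's equation. -/
theorem exists_poissonIntegral_decay (hp : 0 ≤ p) :
    ∃ C : ℝ, 0 < C ∧ ∀ ρ : ℝ, 1 ≤ ρ → |poissonIntegral p ρ| ≤ C * ρ ^ (-(p + 1)) ∧
      |poissonIntegralDeriv p ρ| ≤ C * ρ ^ (-(p + 1)) := by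
  set m := p + 1 with hm
  set c := m * (m - 1) with hcdef
  have hc0 : 0 ≤ c := by rw [hcdef, hm]; nlinarith
  -- Multiplication by `ρ^m` removes the first-order term: with `w = v'`, the equation becomes `v''
  -- = (c/ρ² - 1) v`, a perturbed harmonic oscillator.
  set v : ℝ → ℝ := fun ρ => ρ ^ m * poissonIntegral p ρ with hv
  set w : ℝ → ℝ := fun ρ => ρ ^ m * poissonIntegralDeriv p ρ + m * ρ ^ (m - 1) * poissonIntegral p ρ
    with hw
  have hv' : ∀ ρ, 0 < ρ → HasDerivAt v (w ρ) ρ := by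
    intro ρ hρ
    exact ((Real.hasDerivAt_rpow_const (p := m) (Or.inl hρ.ne')).mul
      (hasDerivAt_poissonIntegral hp ρ)).congr_deriv (by simp only [hw]; ring)
  have hw' : ∀ ρ, 0 < ρ → HasDerivAt w ((c / ρ ^ 2 - 1) * v ρ) ρ := by
    intro ρ hρ
    have h1 := (Real.hasDerivAt_rpow_const (p := m) (Or.inl hρ.ne')).mul
      (hasDerivAt_poissonIntegralDeriv hp ρ)
    have h2 := ((Real.hasDerivAt_rpow_const (p := m - 1) (Or.inl hρ.ne')).const_mul m).mul
      (hasDerivAt_poissonIntegral hp ρ)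
    have hode := poissonIntegral_ode hp ρ
    refine (h1.add h2).congr_deriv ?_
    have e1 : ρ ^ m = ρ ^ (m - 1 - 1) * ρ * ρ := by
      rw [← Real.rpow_add_one hρ.ne', ← Real.rpow_add_one hρ.ne']; ring_nf
    have e2 : ρ ^ (m - 1) = ρ ^ (m - 1 - 1) * ρ := by
      rw [← Real.rpow_add_one hρ.ne']; ring_nf
    simp only [hv]
    rw [e2, e1, hcdef]
    field_simp
    linear_combination ρ * hode
  -- The plain energy `v² + w²` has derivative `2(c/ρ²)vw`. The integrating factor turns the
  -- derivative into `-(c/ρ²)(v - w)²` times a positive factor, so `E` decreases.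
  set E : ℝ → ℝ := fun ρ => (v ρ ^ 2 + w ρ ^ 2) * Real.exp (c / ρ) with hE
  have hE' : ∀ ρ, 0 < ρ → HasDerivAt E ((2 * v ρ * w ρ * (c / ρ ^ 2)
      - (v ρ ^ 2 + w ρ ^ 2) * (c / ρ ^ 2)) * Real.exp (c / ρ)) ρ := by
    intro ρ hρ
    have h1 := ((hv' ρ hρ).pow 2).add ((hw' ρ hρ).pow 2)
    have h2 : HasDerivAt (fun ρ => c / ρ) (-(c / ρ ^ 2)) ρ := by
      have := (hasDerivAt_inv hρ.ne').const_mul c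
      exact this.congr_deriv (by field_simp)
    refine (h1.mul h2.exp).congr_deriv ?_
    simp only [Pi.add_apply, Pi.pow_apply]
    norm_num
    ring
  have hanti : AntitoneOn E (Ici 1) := by
    refine antitoneOn_of_deriv_nonpos (convex_Ici 1)
      (fun ρ hρ => (hE' ρ (by linarith [mem_Ici.1 hρ])).continuousAt.continuousWithinAt)
      (fun ρ hρ => ?_) (fun ρ hρ => ?_)
    · rw [interior_Ici] at hρ
      exact (hE' ρ (by linarith [mem_Ioi.1 hρ])).differentiableAt.differentiableWithinAt
    · rw [interior_Ici] at hρ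
      rw [(hE' ρ (by linarith [mem_Ioi.1 hρ])).deriv]
      refine mul_nonpos_of_nonpos_of_nonneg ?_ (Real.exp_pos _).le
      have : 0 ≤ c / ρ ^ 2 := by positivity
      nlinarith [mul_nonneg this (sq_nonneg (v ρ - w ρ))]
  have hE1 : 0 ≤ E 1 := by simp only [hE]; positivity
  have hbound : ∀ ρ, 1 ≤ ρ → v ρ ^ 2 + w ρ ^ 2 ≤ E 1 := by
    intro ρ hρ
    refine le_trans ?_ (hanti self_mem_Ici hρ hρ)
    have : 1 ≤ Real.exp (c / ρ) := Real.one_le_exp (by positivity)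
    simp only [hE]
    nlinarith [sq_nonneg (v ρ), sq_nonneg (w ρ)]
  have hm0 : 0 < m := by rw [hm]; linarith
  refine ⟨(1 + m) * Real.sqrt (E 1) + 1, by positivity, fun ρ hρ => ?_⟩
  have hρ0 : 0 < ρ := by linarith
  have hv1 : |v ρ| ≤ Real.sqrt (E 1) := Real.abs_le_sqrt (by nlinarith [hbound ρ hρ, sq_nonneg (w ρ)])
  have hw1 : |w ρ| ≤ Real.sqrt (E 1) := Real.abs_le_sqrt (by nlinarith [hbound ρ hρ, sq_nonneg (v ρ)])
  have hpos : 0 < ρ ^ m := Real.rpow_pos_of_pos hρ0 _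
  have hs := Real.sqrt_nonneg (E 1)
  rw [Real.rpow_neg hρ0.le, ← div_eq_mul_inv, le_div_iff₀ hpos, le_div_iff₀ hpos]
  constructor
  · have : |poissonIntegral p ρ| * ρ ^ m = |v ρ| := by
      rw [hv, abs_mul, abs_of_pos hpos, mul_comm]
    rw [this]
    nlinarith
  · have h1 : ρ ^ m * poissonIntegralDeriv p ρ = w ρ - m / ρ * v ρ := by
      simp only [hw, hv]
      rw [Real.rpow_sub_one hρ0.ne']
      ring
    have : |poissonIntegralDeriv p ρ| * ρ ^ m = |w ρ - m / ρ * v ρ| := by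
      rw [← h1, abs_mul, abs_of_pos hpos, mul_comm]
    rw [this]
    have h2 : m / ρ ≤ m := div_le_self hm0.le hρ
    calc |w ρ - m / ρ * v ρ| ≤ |w ρ| + |m / ρ * v ρ| := abs_sub _ _
      _ = |w ρ| + m / ρ * |v ρ| := by rw [abs_mul, abs_of_nonneg (by positivity : 0 ≤ m / ρ)]
      _ ≤ Real.sqrt (E 1) + m * Real.sqrt (E 1) := by gcongr
      _ ≤ _ := by linarith

end Bessel

/-! ### Fourier transforms of balls and thin spherical shells. -/

section BallFourier
open scoped FourierTransform RealInnerProductSpace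

section
variable {V : Type*} [NormedAddCommGroup V] [InnerProductSpace ℝ V] [FiniteDimensional ℝ V]
  [MeasurableSpace V] [BorelSpace V]

/-- The change of variable `v ↦ -v` shows that the transform equals its own conjugate, hence is
real. -/
theorem fourier_indicator_of_symm {s : Set V} (hs : MeasurableSet s) (hb : Bornology.IsBounded s)
    (hsymm : ∀ v, -v ∈ s ↔ v ∈ s) (ξ : V) :
    𝓕 (s.indicator (fun _ => (1 : ℂ))) ξ = ((∫ v in s, Real.cos (2 * Real.pi * ⟪v, ξ⟫) : ℝ) : ℂ) := by
  apply Complex.ext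
  · rw [fourier_indicator_re hs hb, Complex.ofReal_re]
  · rw [Complex.ofReal_im]
    have h1 : 𝓕 (s.indicator (fun _ => (1 : ℂ))) ξ =
        starRingEnd ℂ (𝓕 (s.indicator (fun _ => (1 : ℂ))) ξ) := by
      rw [Real.fourier_eq, ← integral_conj, ← integral_neg_eq_self]
      refine integral_congr_ae (ae_of_all _ fun v => ?_)
      have : s.indicator (fun _ => (1 : ℂ)) (-v) = s.indicator (fun _ => (1 : ℂ)) v := by
        by_cases hv : v ∈ s
        · rw [indicator_of_mem hv, indicator_of_mem ((hsymm v).2 hv)]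
        · rw [indicator_of_notMem hv, indicator_of_notMem (fun h => hv ((hsymm v).1 h))]
      dsimp only
      rw [this]
      by_cases hv : v ∈ s
      · simp [hv, Circle.smul_def, Real.fourierChar_apply, ← Complex.exp_conj, map_ofNat]
      · simp [hv]
    have := congrArg Complex.im h1
    rw [Complex.conj_im] at this
    linarith

/-- Vectors of equal norm are exchanged by the reflection in the hyperplane orthogonal to their
difference, and this reflection preserves both the ball and the volume. -/
theorem integral_closedBall_cos_eq_of_norm_eq {ξ η : V} (h : ‖ξ‖ = ‖η‖) (R : ℝ) :
    ∫ v in Metric.closedBall (0 : V) R, Real.cos (2 * Real.pi * ⟪v, ξ⟫) =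
      ∫ v in Metric.closedBall (0 : V) R, Real.cos (2 * Real.pi * ⟪v, η⟫) := by
  set T := (ℝ ∙ (ξ - η))ᗮ.reflection with hT
  have hTξ : T ξ = η := Submodule.reflection_sub h
  have hmp : MeasurePreserving T volume volume := T.measurePreserving
  have hpre : T ⁻¹' (Metric.closedBall (0 : V) R) = Metric.closedBall (0 : V) R := by
    ext v; simp
  have := hmp.setIntegral_preimage_emb T.toHomeomorph.measurableEmbedding
    (fun v => Real.cos (2 * Real.pi * ⟪v, η⟫)) (Metric.closedBall (0 : V) R)
  rw [← this, hpre, ← hTξ]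
  simp only [LinearIsometryEquiv.inner_map_map]

theorem integral_closedBall_cos_smul {R : ℝ} (hR : 0 < R) (ξ : V) :
    ∫ v in Metric.closedBall (0 : V) R, Real.cos (2 * Real.pi * ⟪v, ξ⟫) =
      R ^ Module.finrank ℝ V *
        ∫ v in Metric.closedBall (0 : V) 1, Real.cos (2 * Real.pi * ⟪v, R • ξ⟫) := by
  have := Measure.setIntegral_comp_smul_of_pos volume
    (fun v : V => Real.cos (2 * Real.pi * ⟪v, ξ⟫)) (Metric.closedBall (0 : V) 1) hR
  rw [smul_unitClosedBall_of_nonneg hR.le] at this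
  simp only [inner_smul_left, inner_smul_right, RCLike.conj_to_real] at this ⊢
  rw [this, smul_eq_mul, ← mul_assoc, mul_inv_cancel₀ (by positivity), one_mul]
end

/-- The splitting of the first coordinate of a Euclidean space. -/
noncomputable def euclideanSplit (n : ℕ) :
    EuclideanSpace ℝ (Fin (n + 1)) ≃ᵐ ℝ × EuclideanSpace ℝ (Fin n) :=
  (MeasurableEquiv.toLp 2 (Fin (n + 1) → ℝ)).symm.trans
    ((MeasurableEquiv.piFinSuccAbove (fun _ => ℝ) 0).trans
      ((MeasurableEquiv.refl ℝ).prodCongr (MeasurableEquiv.toLp 2 (Fin n → ℝ))))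

theorem euclideanSplit_fst (n : ℕ) (v : EuclideanSpace ℝ (Fin (n + 1))) :
    (euclideanSplit n v).1 = v 0 := rfl

theorem norm_sq_euclideanSplit (n : ℕ) (v : EuclideanSpace ℝ (Fin (n + 1))) :
    ‖v‖ ^ 2 = (euclideanSplit n v).1 ^ 2 + ‖(euclideanSplit n v).2‖ ^ 2 := by
  rw [EuclideanSpace.norm_sq_eq, EuclideanSpace.norm_sq_eq, Fin.sum_univ_succ]
  simp only [Real.norm_eq_abs, sq_abs]
  rfl

theorem measurePreserving_euclideanSplit (n : ℕ) :
    MeasurePreserving (euclideanSplit n) volume volume :=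
  ((MeasurePreserving.id volume).prod (PiLp.volume_preserving_toLp (Fin n))).comp
    ((volume_preserving_piFinSuccAbove (fun _ : Fin (n + 1) => ℝ) 0).comp
      (PiLp.volume_preserving_ofLp (Fin (n + 1))))

theorem volume_norm_sq_le {n : ℕ} (c : ℝ) :
    volume.real {y : EuclideanSpace ℝ (Fin n) | ‖y‖ ^ 2 ≤ c} =
      if 0 ≤ c then c ^ ((n : ℝ) / 2) * volume.real (Metric.closedBall (0 : EuclideanSpace ℝ (Fin n)) 1)
      else 0 := by
  split_ifs with hc
  · have : {y : EuclideanSpace ℝ (Fin n) | ‖y‖ ^ 2 ≤ c} = Metric.closedBall 0 (Real.sqrt c) := by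
      ext y
      simp [Real.le_sqrt (norm_nonneg y) hc]
    rw [this, Measure.addHaar_real_closedBall' _ _ (Real.sqrt_nonneg c)]
    congr 1
    rw [finrank_euclideanSpace_fin, Real.sqrt_eq_rpow, ← Real.rpow_natCast, ← Real.rpow_mul hc]
    ring_nf
  · have : {y : EuclideanSpace ℝ (Fin n) | ‖y‖ ^ 2 ≤ c} = ∅ := by
      ext y
      simp only [mem_ofPred_eq, mem_empty_iff_false, iff_false, not_le]
      exact lt_of_lt_of_le (not_le.1 hc) (by positivity)
    rw [this]; simp

/-- Slicing: the section of the ball at first coordinate `s` is an `n`-dimensional ball of radius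
`(1 - s²)^(1/2)`. This is the source of the Poisson index `n/2`. -/
theorem integral_unitBall_comp_coord {n : ℕ} {g : ℝ → ℝ} (hg : Continuous g) :
    ∫ v in Metric.closedBall (0 : EuclideanSpace ℝ (Fin (n + 1))) 1, g (v 0) =
      volume.real (Metric.closedBall (0 : EuclideanSpace ℝ (Fin n)) 1) *
        ∫ s in (-1 : ℝ)..1, g s * (1 - s ^ 2) ^ ((n : ℝ) / 2) := by
  set κ := volume.real (Metric.closedBall (0 : EuclideanSpace ℝ (Fin n)) 1)
  set B : Set (ℝ × EuclideanSpace ℝ (Fin n)) := {q | ‖q.2‖ ^ 2 ≤ 1 - q.1 ^ 2} with hB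
  have hBm : MeasurableSet B := (isClosed_le (by fun_prop) (by fun_prop)).measurableSet
  have hpre : euclideanSplit n ⁻¹' B = Metric.closedBall 0 1 := by
    ext v
    have := norm_sq_euclideanSplit n v
    simp only [hB, mem_preimage, mem_ofPred_eq, mem_closedBall_zero_iff]
    rw [← sq_le_one_iff₀ (norm_nonneg v), this]
    constructor <;> intro h <;> linarith
  have hmp := measurePreserving_euclideanSplit n
  have h1 := hmp.setIntegral_preimage_emb (euclideanSplit n).measurableEmbedding
    (fun q => g q.1) B
  rw [hpre] at h1
  have hint : IntegrableOn (fun q : ℝ × EuclideanSpace ℝ (Fin n) => g q.1) B := by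
    rw [← hmp.integrableOn_comp_preimage (euclideanSplit n).measurableEmbedding, hpre]
    refine ContinuousOn.integrableOn_compact (isCompact_closedBall _ _)
      (Continuous.continuousOn ?_)
    exact hg.comp (by fun_prop : Continuous fun v : EuclideanSpace ℝ (Fin (n + 1)) => v 0)
  simp only [euclideanSplit_fst] at h1
  rw [h1, ← integral_indicator hBm, Measure.volume_eq_prod,
    integral_prod _ ((integrable_indicator_iff hBm).2 hint)]
  have h2 : ∀ s : ℝ, ∫ y : EuclideanSpace ℝ (Fin n), B.indicator (fun q => g q.1) (s, y) =
      (Icc (-1 : ℝ) 1).indicator (fun s => κ * (g s * (1 - s ^ 2) ^ ((n : ℝ) / 2))) s := by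
    intro s
    have : (fun y : EuclideanSpace ℝ (Fin n) => B.indicator (fun q => g q.1) (s, y)) =
        {y : EuclideanSpace ℝ (Fin n) | ‖y‖ ^ 2 ≤ 1 - s ^ 2}.indicator (fun _ => g s) := by
      ext y
      simp only [hB, indicator, mem_ofPred_eq]
    rw [this, integral_indicator_const _ (isClosed_le (by fun_prop) (by fun_prop)).measurableSet,
      volume_norm_sq_le]
    have hiff : s ∈ Icc (-1 : ℝ) 1 ↔ 0 ≤ 1 - s ^ 2 := by
      rw [sub_nonneg, sq_le_one_iff_abs_le_one, abs_le, mem_Icc]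
    by_cases hs : 0 ≤ 1 - s ^ 2
    · rw [if_pos hs, indicator_of_mem (hiff.2 hs), smul_eq_mul]
      ring
    · rw [if_neg hs, indicator_of_notMem (fun h => hs (hiff.1 h)), zero_smul]
  simp_rw [h2]
  rw [integral_indicator measurableSet_Icc, integral_Icc_eq_integral_Ioc,
    ← intervalIntegral.integral_of_le (by norm_num), intervalIntegral.integral_const_mul]

/-- The Fourier transform of a ball, in terms of Bessel functions. -/
theorem integral_closedBall_cos {n : ℕ} {R : ℝ} (hR : 0 < R)
    (ξ : EuclideanSpace ℝ (Fin (n + 1))) :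
    ∫ v in Metric.closedBall (0 : EuclideanSpace ℝ (Fin (n + 1))) R,
      Real.cos (2 * Real.pi * ⟪v, ξ⟫) =
      volume.real (Metric.closedBall (0 : EuclideanSpace ℝ (Fin n)) 1) *
        (R ^ (n + 1) * poissonIntegral ((n : ℝ) / 2) (2 * Real.pi * ‖ξ‖ * R)) := by
  have h0 : ‖R • ξ‖ = ‖EuclideanSpace.single (0 : Fin (n + 1)) (R * ‖ξ‖)‖ := by
    rw [norm_smul, PiLp.norm_single, norm_mul, norm_norm]
  rw [integral_closedBall_cos_smul hR, integral_closedBall_cos_eq_of_norm_eq h0]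
  have h1 := integral_unitBall_comp_coord (n := n)
    (g := fun s => Real.cos (2 * Real.pi * ‖ξ‖ * R * s)) (by fun_prop)
  have h2 : ∀ v : EuclideanSpace ℝ (Fin (n + 1)), Real.cos (2 * Real.pi *
      ⟪v, EuclideanSpace.single (0 : Fin (n + 1)) (R * ‖ξ‖)⟫) =
        Real.cos (2 * Real.pi * ‖ξ‖ * R * v 0) := by
    intro v
    rw [EuclideanSpace.inner_single_right]
    simp only [RCLike.conj_to_real]
    ring_nf
  simp_rw [h2]
  rw [h1, finrank_euclideanSpace_fin, poissonIntegral]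
  ring

/-- The Fourier transform of a thin spherical shell decays like that of the sphere. -/
theorem exists_norm_fourier_shell_le {n : ℕ} {t : ℝ} (ht : 0 < t) :
    ∃ C : ℝ, 0 < C ∧ ∀ δ : ℝ, 0 < δ → δ ≤ t / 4 → ∀ ξ : EuclideanSpace ℝ (Fin (n + 1)),
      ‖𝓕 ((Metric.closedBall (0 : EuclideanSpace ℝ (Fin (n + 1))) (t + 2 * δ) \
        Metric.closedBall 0 (t - 2 * δ)).indicator (fun _ => (1 : ℂ))) ξ‖ ≤ C * δ ∧
      ∀ r : ℝ, 0 < r → 1 / (6 * r) ≤ ‖ξ‖ →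
        ‖𝓕 ((Metric.closedBall (0 : EuclideanSpace ℝ (Fin (n + 1))) (t + 2 * δ) \
        Metric.closedBall 0 (t - 2 * δ)).indicator (fun _ => (1 : ℂ))) ξ‖ ≤
          C * δ * r ^ ((n : ℝ) / 2) := by
  set κ := volume.real (Metric.closedBall (0 : EuclideanSpace ℝ (Fin n)) 1)
  have hp : (0 : ℝ) ≤ (n : ℝ) / 2 := by positivity
  set p := (n : ℝ) / 2 with hpdef
  obtain ⟨C₀, hC₀, hdec⟩ := exists_poissonIntegral_decay hp
  set D := κ * (2 * t) ^ n * (n + 2) * (C₀ + 2) with hD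
  have hκ : 0 ≤ κ := measureReal_nonneg
  have hD0 : 0 ≤ D := by positivity
  have hπ := Real.pi_pos
  have hder : ∀ (a R : ℝ), HasDerivAt (fun R => κ * (R ^ (n + 1) * poissonIntegral p (a * R)))
      (κ * ((n + 1) * R ^ n * poissonIntegral p (a * R) +
        R ^ (n + 1) * (poissonIntegralDeriv p (a * R) * a))) R := by
    intro a R
    have h1 := (hasDerivAt_poissonIntegral hp (a * R)).comp R ((hasDerivAt_id R).const_mul a)
    refine (((hasDerivAt_pow (n + 1) R).mul h1).const_mul κ).congr_deriv ?_
    simp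
  -- Bounds for the derivative in `R` of the transform of the ball. Differentiating brings out a
  -- factor `a`, which costs one power of `ρ = aR`: the decay drops from `ρ^(-(p+1))` to `ρ^(-p)`,
  -- as for the sphere.
  have hbd : ∀ (a R : ℝ), 0 ≤ a → t / 2 ≤ R → R ≤ 2 * t →
      |κ * ((n + 1) * R ^ n * poissonIntegral p (a * R) +
        R ^ (n + 1) * (poissonIntegralDeriv p (a * R) * a))| ≤ D ∧
      (0 < a → |κ * ((n + 1) * R ^ n * poissonIntegral p (a * R) +
        R ^ (n + 1) * (poissonIntegralDeriv p (a * R) * a))| ≤ D * (a * R) ^ (-p)) := by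
    intro a R ha hR1 hR2
    have hR : 0 < R := by linarith
    set ρ := a * R with hρ
    have hρ0 : 0 ≤ ρ := by positivity
    have hRn : R ^ n ≤ (2 * t) ^ n := by gcongr
    have e1 : |κ * ((n + 1) * R ^ n * poissonIntegral p ρ +
        R ^ (n + 1) * (poissonIntegralDeriv p ρ * a))| ≤
        κ * (2 * t) ^ n * ((n + 1) * |poissonIntegral p ρ| + ρ * |poissonIntegralDeriv p ρ|) := by
      have : κ * ((n + 1) * R ^ n * poissonIntegral p ρ +
        R ^ (n + 1) * (poissonIntegralDeriv p ρ * a)) =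
        κ * R ^ n * ((n + 1) * poissonIntegral p ρ + ρ * poissonIntegralDeriv p ρ) := by
        rw [hρ]; ring
      rw [this, abs_mul, abs_of_nonneg (by positivity : 0 ≤ κ * R ^ n)]
      have h3 : |(n + 1) * poissonIntegral p ρ + ρ * poissonIntegralDeriv p ρ| ≤
          (n + 1) * |poissonIntegral p ρ| + ρ * |poissonIntegralDeriv p ρ| := by
        refine (abs_add_le _ _).trans ?_
        rw [abs_mul, abs_mul, abs_of_nonneg hρ0, abs_of_nonneg (by positivity : (0 : ℝ) ≤ n + 1)]
      gcongr
    obtain ⟨b1, b2⟩ := abs_poissonIntegral_le hp ρ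
    have e2 : ρ ≤ 1 → |κ * ((n + 1) * R ^ n * poissonIntegral p ρ +
        R ^ (n + 1) * (poissonIntegralDeriv p ρ * a))| ≤ D := by
      intro h
      refine e1.trans ?_
      rw [hD, mul_assoc _ ((n : ℝ) + 2)]
      refine mul_le_mul_of_nonneg_left ?_ (by positivity)
      have : ρ * |poissonIntegralDeriv p ρ| ≤ 1 * 2 := mul_le_mul h b2 (abs_nonneg _) zero_le_one
      have hn0 : (0 : ℝ) ≤ n := by positivity
      nlinarith
    have e3 : 1 ≤ ρ → |κ * ((n + 1) * R ^ n * poissonIntegral p ρ +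
        R ^ (n + 1) * (poissonIntegralDeriv p ρ * a))| ≤ D * ρ ^ (-p) := by
      intro h
      obtain ⟨d1, d2⟩ := hdec ρ h
      have hρp : 0 < ρ := by linarith
      have h4 : ρ * ρ ^ (-(p + 1)) = ρ ^ (-p) := by
        rw [mul_comm, ← Real.rpow_add_one hρp.ne']; ring_nf
      have h5 : ρ ^ (-(p + 1)) ≤ ρ ^ (-p) := Real.rpow_le_rpow_of_exponent_le h (by linarith)
      have h6 : 0 ≤ ρ ^ (-p) := by positivity
      refine e1.trans ?_
      calc κ * (2 * t) ^ n * ((n + 1) * |poissonIntegral p ρ| + ρ * |poissonIntegralDeriv p ρ|)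
          ≤ κ * (2 * t) ^ n * ((n + 1) * (C₀ * ρ ^ (-(p + 1))) + ρ * (C₀ * ρ ^ (-(p + 1)))) := by
            gcongr
        _ = κ * (2 * t) ^ n * ((n + 1) * (C₀ * ρ ^ (-(p + 1))) + C₀ * ρ ^ (-p)) := by
            rw [← h4]; ring
        _ ≤ κ * (2 * t) ^ n * ((n + 1) * (C₀ * ρ ^ (-p)) + C₀ * ρ ^ (-p)) := by gcongr
        _ = κ * (2 * t) ^ n * (n + 2) * C₀ * ρ ^ (-p) := by ring
        _ ≤ κ * (2 * t) ^ n * (n + 2) * (C₀ + 2) * ρ ^ (-p) := by gcongr; linarith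
    constructor
    · rcases le_total ρ 1 with h | h
      · exact e2 h
      · refine (e3 h).trans (mul_le_of_le_one_right hD0 ?_)
        exact Real.rpow_le_one_of_one_le_of_nonpos h (by linarith)
    · intro ha'
      rcases le_total ρ 1 with h | h
      · refine (e2 h).trans (le_mul_of_one_le_right hD0 ?_)
        exact Real.one_le_rpow_of_pos_of_le_one_of_nonpos (by positivity) h (by linarith)
      · exact e3 h
  set C₁ := (6 / (Real.pi * t)) ^ p with hC₁
  have hC₁0 : 0 < C₁ := by positivity
  refine ⟨4 * D * (1 + C₁) + 1, by positivity, fun δ hδ hδt ξ => ?_⟩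
  set s : Set (EuclideanSpace ℝ (Fin (n + 1))) :=
    Metric.closedBall 0 (t + 2 * δ) \ Metric.closedBall 0 (t - 2 * δ) with hs
  have hsm : MeasurableSet s := Metric.isClosed_closedBall.measurableSet.diff
    Metric.isClosed_closedBall.measurableSet
  have hF : 𝓕 (s.indicator (fun _ => (1 : ℂ))) ξ =
      ((κ * ((t + 2 * δ) ^ (n + 1) * poissonIntegral p (2 * Real.pi * ‖ξ‖ * (t + 2 * δ))) -
        κ * ((t - 2 * δ) ^ (n + 1) * poissonIntegral p (2 * Real.pi * ‖ξ‖ * (t - 2 * δ))) : ℝ) : ℂ) := by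
    rw [fourier_indicator_of_symm hsm (Metric.isBounded_closedBall.subset sdiff_subset)
      (by intro v; simp [hs]) ξ, ← integral_closedBall_cos (by linarith) ξ,
      ← integral_closedBall_cos (by linarith) ξ, hs,
      setIntegral_sdiff Metric.isClosed_closedBall.measurableSet]
    · exact ContinuousOn.integrableOn_compact (isCompact_closedBall _ _)
        (Continuous.continuousOn (by fun_prop))
    · exact Metric.closedBall_subset_closedBall (by linarith)
  -- The transform of the shell is a difference of two ball transforms whose radii differ by `4δ`,
  -- so the mean value inequality gains the factor `δ`.
  have hmvt : ∀ B : ℝ, (∀ R ∈ Icc (t - 2 * δ) (t + 2 * δ),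
      |κ * ((n + 1) * R ^ n * poissonIntegral p (2 * Real.pi * ‖ξ‖ * R) +
        R ^ (n + 1) * (poissonIntegralDeriv p (2 * Real.pi * ‖ξ‖ * R) * (2 * Real.pi * ‖ξ‖)))| ≤ B) →
      ‖𝓕 (s.indicator (fun _ => (1 : ℂ))) ξ‖ ≤ B * (4 * δ) := by
    intro B hB
    have := (convex_Icc (t - 2 * δ) (t + 2 * δ)).norm_image_sub_le_of_norm_hasDerivWithin_le
      (fun R _ => (hder (2 * Real.pi * ‖ξ‖) R).hasDerivWithinAt) hB
      (left_mem_Icc.2 (by linarith)) (right_mem_Icc.2 (by linarith))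
    rw [hF, Complex.norm_real]
    refine this.trans (le_of_eq ?_)
    rw [Real.norm_eq_abs, abs_of_nonneg (by linarith)]
    ring
  constructor
  · refine (hmvt D fun R hR => ?_).trans ?_
    · exact (hbd _ R (by positivity) (by linarith [hR.1]) (by linarith [hR.2])).1
    · nlinarith [mul_nonneg hD0 hC₁0.le]
  · intro r hr hξ
    have hξ0 : 0 < ‖ξ‖ := lt_of_lt_of_le (by positivity) hξ
    refine (hmvt (D * (C₁ * r ^ p)) fun R hR => ?_).trans ?_
    · refine ((hbd _ R (by positivity) (by linarith [hR.1]) (by linarith [hR.2])).2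
        (by positivity)).trans ?_
      gcongr
      -- Combines `‖ξ‖ ≥ 1/(6r)` with `R ≥ t/2`; this dictates the value of `C₁`.
      have h1 : Real.pi * t / (6 * r) ≤ 2 * Real.pi * ‖ξ‖ * R := by
        have : t / 2 ≤ R := by linarith [hR.1]
        calc Real.pi * t / (6 * r) = 2 * Real.pi * (1 / (6 * r)) * (t / 2) := by field_simp
          _ ≤ _ := by gcongr
      have h2 : Real.pi * t / (6 * r) = (6 / (Real.pi * t) * r)⁻¹ := by field_simp
      calc (2 * Real.pi * ‖ξ‖ * R) ^ (-p) ≤ (Real.pi * t / (6 * r)) ^ (-p) :=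
            Real.rpow_le_rpow_of_nonpos (by positivity) h1 (by linarith)
        _ = C₁ * r ^ p := by
            rw [h2, Real.rpow_neg (by positivity), Real.inv_rpow (by positivity), inv_inv,
              Real.mul_rpow (by positivity) hr.le]
    · have : 0 < r ^ p := by positivity
      have h3 : D * (C₁ * r ^ p) * (4 * δ) = 4 * D * C₁ * (δ * r ^ p) := by ring
      have h4 : 0 < δ * r ^ p := by positivity
      rw [h3, mul_assoc (4 * D * (1 + C₁) + 1)]
      gcongr
      nlinarith

end BallFourier

/-! ### The norm on `L²(A)` of convolution with a shell. -/

section ShellOperator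
open scoped FourierTransform Convolution

/-- The spherical shell of radius `t` and width `4δ` around the origin. -/
def shell (n : ℕ) (t δ : ℝ) : Set (EuclideanSpace ℝ (Fin (n + 1))) :=
  Metric.closedBall 0 (t + 2 * δ) \ Metric.closedBall 0 (t - 2 * δ)

theorem measurableSet_shell (n : ℕ) (t δ : ℝ) : MeasurableSet (shell n t δ) :=
  Metric.isClosed_closedBall.measurableSet.diff Metric.isClosed_closedBall.measurableSet

theorem isBounded_shell (n : ℕ) (t δ : ℝ) : Bornology.IsBounded (shell n t δ) :=
  Metric.isBounded_closedBall.subset sdiff_subset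

/-- The convolution operator with a spherical shell is bounded on `L²(A)` if the set `A` satisfies
a discretised dimension condition at the scale of the shell. -/
theorem exists_shell_convolution_bound (n : ℕ) {t C α ε γ : ℝ} (ht : 0 < t) (hC : 0 < C)
    (hε : 0 < ε) (hγ0 : 0 ≤ γ) (hγ : ((n : ℝ) + 2) / 2 - α ≤ γ) :
    ∃ C' : ℝ, 0 < C' ∧ ∀ δ : ℝ, 0 < δ → δ ≤ 1 → δ ≤ t / 4 →
      ∀ A : Set (EuclideanSpace ℝ (Fin (n + 1))), MeasurableSet A →
      (∀ (x : EuclideanSpace ℝ (Fin (n + 1))) (r : ℝ), δ ≤ r → volume (A ∩ Metric.ball x r) ≤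
        ENNReal.ofReal (C * (r / δ) ^ (α + ε) * δ ^ (((n + 1 : ℕ) : ℝ) - ε))) →
      ∀ f : EuclideanSpace ℝ (Fin (n + 1)) → ℂ, Integrable f → MemLp f 2 volume →
        (∀ x, x ∉ A → f x = 0) →
        ∫⁻ x in A, ‖((shell n t δ).indicator (fun _ => (1 : ℂ))
          ⋆[ContinuousLinearMap.mul ℂ ℂ] f) x‖ₑ ^ 2 ≤
        ENNReal.ofReal (C' * δ ^ ((n : ℝ) + 2 - α - γ - 2 * ε)) ^ 2 * ∫⁻ x, ‖f x‖ₑ ^ 2 := by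
  obtain ⟨C₁, hC₁, hdec⟩ := exists_norm_fourier_shell_le (n := n) ht
  set p := (n : ℝ) / 2 with hp
  have hp0 : 0 ≤ p := by positivity
  set v := volume.real (Metric.closedBall (0 : EuclideanSpace ℝ (Fin (n + 1))) 1) with hv
  have hv0 : 0 < v := ENNReal.toReal_pos (Metric.measure_closedBall_pos volume _ one_pos).ne'
    Metric.isBounded_closedBall.measure_lt_top.ne
  -- The regularity exponent `α + ε` leaves a spare factor `r_j^ε = q^j`, so the sum over scales is
  -- geometric even at the critical exponent.
  set q : ℝ := (1 / 2 : ℝ) ^ ε with hq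
  have hq0 : 0 < q := by positivity
  have hq1 : q < 1 := Real.rpow_lt_one (by norm_num) (by norm_num) hε
  set D := C₁ * 2 ^ p * (4 * (C * 2 ^ (α + ε)) / v) with hD
  have hD0 : 0 < D := by positivity
  refine ⟨D * (1 - q)⁻¹ + C₁ * 2 ^ p, ?_, fun δ hδ hδ1 hδt A hA hreg f hf hf2 hfA => ?_⟩
  · have : 0 < (1 - q)⁻¹ := inv_pos.2 (by linarith)
    positivity
  -- Dyadic radii run from `1` down to the last one that is at least `δ`, below which regularity
  -- says nothing.
  obtain ⟨J, hJ1, hJ2⟩ := exists_nat_pow_near_of_lt_one hδ hδ1 (by norm_num : (0 : ℝ) < 1 / 2)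
    (by norm_num)
  set r : ℕ → ℝ := fun j => (1 / 2 : ℝ) ^ j with hr
  have hr0 : ∀ j, 0 < r j := fun j => by positivity
  have hr1 : ∀ j, r j ≤ 1 := fun j => pow_le_one₀ (by norm_num) (by norm_num)
  have hrs : ∀ j, r j = 2 * r (j + 1) := fun j => by simp only [hr, pow_succ]; ring
  have hrδ : ∀ j ∈ Finset.range (J + 1), δ ≤ r j := by
    intro j hj
    refine hJ2.trans (pow_le_pow_of_le_one (by norm_num) (by norm_num) ?_)
    exact Nat.lt_succ_iff.1 (Finset.mem_range.1 hj)
  set a : ℕ → ℝ := fun j => C₁ * 2 ^ p * δ * r j ^ p with ha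
  set b : ℝ := C₁ * 2 ^ p * δ * δ ^ p with hb
  -- The radius is doubled because closed balls must fit into the open balls of the hypothesis.
  set S : ℕ → ℝ := fun j => C * (2 * r j / δ) ^ (α + ε) * δ ^ (((n + 1 : ℕ) : ℝ) - ε) with hS
  have key := lintegral_convolution_sq_le hA (n := J + 1) hr0 (S := fun j => ENNReal.ofReal (S j))
    (a := fun j => ENNReal.ofReal (a j)) (b := ENNReal.ofReal b) (M := 1)
    (fun j hj x => by
      refine (measure_mono (inter_subset_inter_right A (Metric.closedBall_subset_ball ?_))).trans
        (hreg x (2 * r j) ?_)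
      · linarith [hr0 j]
      · linarith [hr0 j, hrδ j hj])
    (integrable_indicator_one (measurableSet_shell n t δ) (isBounded_shell n t δ))
    (fun x => by
      by_cases hx : x ∈ shell n t δ
      · simp [indicator_of_mem hx]
      · simp [indicator_of_notMem hx])
    (fun ξ => by
      obtain ⟨h1, h2⟩ := hdec δ hδ hδt ξ
      rw [← ofReal_norm]
      -- The least such `j` captures the size of `ξ`: the previous dual ball misses `ξ`, so the
      -- decay holds at radius `r (j - 1) = 2 * r j`, whence the factor `2 ^ p` in `a`. For `j = 0`
      -- the uniform bound is used. If no such `j` exists, the frequency exceeds `1/(6 r_J)` with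
      -- `r_J ≤ 2δ` and is charged to `b`.
      by_cases hex : ∃ j, j ∈ Finset.range (J + 1) ∧ ‖ξ‖ ≤ 1 / (6 * r j)
      · classical
        have hsp := Nat.find_spec hex
        set j := Nat.find hex with hj
        refine le_trans ?_ (le_trans (Finset.single_le_sum (fun _ _ => zero_le) hsp.1)
          le_self_add)
        rw [indicator_of_mem (mem_closedBall_zero_iff.2 hsp.2)]
        refine ENNReal.ofReal_le_ofReal ?_
        by_cases hj0 : j = 0
        · refine h1.trans ?_
          rw [hj0]
          have : 1 ≤ (2 : ℝ) ^ p := Real.one_le_rpow (by norm_num) hp0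
          have hC₁δ : 0 < C₁ * δ := by positivity
          simp only [ha, hr, pow_zero, Real.one_rpow, mul_one]
          nlinarith
        · obtain ⟨i, hi⟩ := Nat.exists_eq_succ_of_ne_zero hj0
          have hmin := Nat.find_min hex (m := i) (by omega)
          have hi' : i ∈ Finset.range (J + 1) := by
            have := Finset.mem_range.1 hsp.1
            exact Finset.mem_range.2 (by omega)
          have h3 : 1 / (6 * r i) ≤ ‖ξ‖ := by
            by_contra h
            exact hmin ⟨hi', (not_le.1 h).le⟩
          refine (h2 (r i) (hr0 i) h3).trans (le_of_eq ?_)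
          rw [hi]
          simp only [ha]
          rw [hrs i, Real.mul_rpow (by norm_num) (hr0 _).le]
          ring
      · push Not at hex
        refine le_trans ?_ le_add_self
        refine ENNReal.ofReal_le_ofReal ?_
        have hJm : J ∈ Finset.range (J + 1) := Finset.self_mem_range_succ J
        refine (h2 (r J) (hr0 J) (hex J hJm).le).trans ?_
        have h3 : r J ≤ 2 * δ := by rw [hrs J]; linarith [hJ1]
        have h4 : r J ^ p ≤ 2 ^ p * δ ^ p := by
          rw [← Real.mul_rpow (by norm_num) hδ.le]
          exact Real.rpow_le_rpow (hr0 J).le h3 hp0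
        calc C₁ * δ * r J ^ p ≤ C₁ * δ * (2 ^ p * δ ^ p) := by gcongr
          _ = b := by rw [hb]; ring)
    hf hf2 hfA
  refine key.trans ?_
  gcongr
  set T := δ ^ ((n : ℝ) + 2 - α - γ - 2 * ε) with hT
  have hterm : ∀ j ∈ Finset.range (J + 1), ENNReal.ofReal (a j) * (4 * ENNReal.ofReal (S j) /
      volume (Metric.closedBall (0 : EuclideanSpace ℝ (Fin (n + 1))) (r j))) ≤
      ENNReal.ofReal (D * T * q ^ j) := by
    intro j hj
    have hvol : volume (Metric.closedBall (0 : EuclideanSpace ℝ (Fin (n + 1))) (r j)) =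
        ENNReal.ofReal (r j ^ (n + 1) * v) := by
      rw [Measure.addHaar_closedBall' _ _ (hr0 j).le, finrank_euclideanSpace_fin,
        ENNReal.ofReal_mul (by positivity), hv, Measure.real,
        ENNReal.ofReal_toReal Metric.isBounded_closedBall.measure_lt_top.ne]
    have h4 : (4 : ℝ≥0∞) = ENNReal.ofReal 4 := by simp
    have hrj := hr0 j
    rw [hvol, h4, ← ENNReal.ofReal_mul (by norm_num), ← ENNReal.ofReal_div_of_pos (by positivity),
      ← ENNReal.ofReal_mul (by positivity)]
    refine ENNReal.ofReal_le_ofReal ?_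
    have e1 : (2 * r j / δ) ^ (α + ε) = 2 ^ (α + ε) * r j ^ (α + ε) * δ ^ (-(α + ε)) := by
      rw [Real.div_rpow (by positivity) hδ.le, Real.mul_rpow (by norm_num) hrj.le,
        Real.rpow_neg hδ.le, div_eq_mul_inv]
    have e2 : a j * (4 * S j / (r j ^ (n + 1) * v)) =
        D * ((r j ^ p * r j ^ (α + ε) * r j ^ (-((n + 1 : ℕ) : ℝ))) *
          (δ ^ (1 : ℝ) * δ ^ (-(α + ε)) * δ ^ (((n + 1 : ℕ) : ℝ) - ε))) := by
      rw [Real.rpow_neg hrj.le, Real.rpow_natCast, Real.rpow_one]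
      simp only [ha, hS, hD]
      rw [e1]
      field_simp
    have e3 : r j ^ p * r j ^ (α + ε) * r j ^ (-((n + 1 : ℕ) : ℝ)) =
        r j ^ (α - ((n : ℝ) + 2) / 2) * r j ^ ε := by
      rw [← Real.rpow_add hrj, ← Real.rpow_add hrj, ← Real.rpow_add hrj]
      congr 1
      rw [hp]; push_cast; ring
    have e4 : δ ^ (1 : ℝ) * δ ^ (-(α + ε)) * δ ^ (((n + 1 : ℕ) : ℝ) - ε) = T * δ ^ γ := by
      rw [hT, ← Real.rpow_add hδ, ← Real.rpow_add hδ, ← Real.rpow_add hδ]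
      congr 1
      push_cast; ring
    have e5 : r j ^ ε = q ^ j := by
      rw [hq, ← Real.rpow_natCast, ← Real.rpow_mul (by norm_num), mul_comm ε,
        Real.rpow_mul (by norm_num), Real.rpow_natCast]
    -- The only place where the loss `γ` arises: the exponent on the left is at least `-γ`, and `δ ≤
    -- r j ≤ 1`.
    have e6 : r j ^ (α - ((n : ℝ) + 2) / 2) ≤ δ ^ (-γ) := by
      calc r j ^ (α - ((n : ℝ) + 2) / 2) ≤ r j ^ (-γ) :=
            Real.rpow_le_rpow_of_exponent_ge hrj (hr1 j) (by linarith)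
        _ ≤ δ ^ (-γ) := Real.rpow_le_rpow_of_nonpos hδ (hrδ j hj) (by linarith)
    have e7 : δ ^ (-γ) * δ ^ γ = 1 := by rw [← Real.rpow_add hδ]; simp
    have hT0 : 0 < T := by positivity
    rw [e2, e3, e4, e5]
    calc D * (r j ^ (α - ((n : ℝ) + 2) / 2) * q ^ j * (T * δ ^ γ))
        ≤ D * (δ ^ (-γ) * q ^ j * (T * δ ^ γ)) := by gcongr
      _ = D * T * q ^ j * (δ ^ (-γ) * δ ^ γ) := by ring
      _ = D * T * q ^ j := by rw [e7, mul_one]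
  have hT0 : 0 < T := by positivity
  calc _ ≤ ∑ j ∈ Finset.range (J + 1), ENNReal.ofReal (D * T * q ^ j) + ENNReal.ofReal b :=
        add_le_add_left (Finset.sum_le_sum hterm) _
    _ = ENNReal.ofReal (∑ j ∈ Finset.range (J + 1), D * T * q ^ j + b) := by
        rw [ENNReal.ofReal_add (Finset.sum_nonneg fun j _ => by positivity) (by positivity),
          ENNReal.ofReal_sum_of_nonneg fun j _ => by positivity]
    _ ≤ _ := by
        refine ENNReal.ofReal_le_ofReal ?_
        have h1 : ∑ j ∈ Finset.range (J + 1), D * T * q ^ j ≤ D * T * (1 - q)⁻¹ := by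
          rw [← Finset.mul_sum]
          gcongr
          rw [← tsum_geometric_of_lt_one hq0.le hq1]
          exact (summable_geometric_of_lt_one hq0.le hq1).sum_le_tsum _ fun j _ => by positivity
        have h2 : b ≤ C₁ * 2 ^ p * T := by
          rw [hb, mul_assoc (C₁ * 2 ^ p)]
          gcongr
          rw [mul_comm, ← Real.rpow_add_one hδ.ne']
          refine Real.rpow_le_rpow_of_exponent_ge hδ hδ1 ?_
          rw [hp]; linarith
        calc _ ≤ D * T * (1 - q)⁻¹ + C₁ * 2 ^ p * T := add_le_add h1 h2
          _ = _ := by ring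

end ShellOperator

/-! ### Volumes of chains by iterated convolution. -/

section Chains
open scoped Convolution

variable {V : Type*} [NormedAddCommGroup V] [InnerProductSpace ℝ V] [FiniteDimensional ℝ V]
  [MeasurableSpace V] [BorelSpace V]

/-- Chains in `A` whose consecutive differences lie in prescribed sets. -/
def diffChains (A : Set V) {k : ℕ} (s : Fin k → Set V) : Set (Fin (k + 1) → V) :=
  {x | (∀ j, x j ∈ A) ∧ ∀ i : Fin k, x i.castSucc - x i.succ ∈ s i}

theorem measurableSet_diffChains {A : Set V} (hA : MeasurableSet A) {k : ℕ} {s : Fin k → Set V}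
    (hs : ∀ i, MeasurableSet (s i)) : MeasurableSet (diffChains A s) := by
  have : diffChains A s = (⋂ j, (fun x : Fin (k + 1) → V => x j) ⁻¹' A) ∩
      ⋂ i : Fin k, (fun x : Fin (k + 1) → V => x i.castSucc - x i.succ) ⁻¹' (s i) := by
    ext x; simp [diffChains]
  rw [this]
  exact (MeasurableSet.iInter fun j => hA.preimage (by fun_prop)).inter
    (MeasurableSet.iInter fun i => (hs i).preimage (by fun_prop))

/-- The volume of the set of continuations of a chain with given starting point. -/
noncomputable def chainFiber (A : Set V) {k : ℕ} (s : Fin k → Set V) (x : V) : ℝ≥0∞ :=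
  volume {y : Fin k → V | (Fin.cons x y : Fin (k + 1) → V) ∈ diffChains A s}

theorem measurePreserving_fin_cons (k : ℕ) :
    MeasurePreserving (fun q : V × (Fin k → V) => (Fin.cons q.1 q.2 : Fin (k + 1) → V))
      (volume.prod volume) volume := by
  have := (volume_preserving_piFinSuccAbove (fun _ : Fin (k + 1) => V) 0).symm
  have h2 : ((MeasurableEquiv.piFinSuccAbove (fun _ : Fin (k + 1) => V) 0).symm :
      V × (Fin k → V) → Fin (k + 1) → V) = fun q => Fin.cons q.1 q.2 := by
    ext q : 1
    exact Fin.insertNth_zero' q.1 q.2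
  rwa [h2] at this

theorem volume_eq_lintegral_cons {k : ℕ} {Z : Set (Fin (k + 1) → V)} (hZ : MeasurableSet Z) :
    volume Z = ∫⁻ x, volume {y : Fin k → V | (Fin.cons x y : Fin (k + 1) → V) ∈ Z} := by
  have hmp := measurePreserving_fin_cons (V := V) k
  rw [← hmp.measure_preimage hZ.nullMeasurableSet, Measure.prod_apply (hmp.measurable hZ)]
  rfl

theorem measurable_chainFiber {A : Set V} (hA : MeasurableSet A) {k : ℕ} {s : Fin k → Set V}
    (hs : ∀ i, MeasurableSet (s i)) : Measurable (chainFiber A s) :=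
  measurable_measure_prodMk_left
    ((measurePreserving_fin_cons (V := V) k).measurable (measurableSet_diffChains hA hs))

theorem volume_diffChains_eq {A : Set V} (hA : MeasurableSet A) {k : ℕ} {s : Fin k → Set V}
    (hs : ∀ i, MeasurableSet (s i)) : volume (diffChains A s) = ∫⁻ x, chainFiber A s x :=
  volume_eq_lintegral_cons (measurableSet_diffChains hA hs)

theorem chainFiber_of_notMem {A : Set V} {k : ℕ} {s : Fin k → Set V} {x : V} (hx : x ∉ A) :
    chainFiber A s x = 0 := by
  have : {y : Fin k → V | (Fin.cons x y : Fin (k + 1) → V) ∈ diffChains A s} = ∅ := by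
    ext y
    simp only [diffChains, mem_ofPred_eq, mem_empty_iff_false, iff_false]
    intro h
    exact hx (by simpa using h.1 0)
  rw [chainFiber, this, measure_empty]

theorem cons_mem_diffChains_iff {A : Set V} {k : ℕ} {s : Fin (k + 1) → Set V} {x : V}
    {y : Fin (k + 1) → V} : (Fin.cons x y : Fin (k + 2) → V) ∈ diffChains A s ↔
      x ∈ A ∧ x - y 0 ∈ s 0 ∧ y ∈ diffChains A (fun i => s i.succ) := by
  simp only [diffChains, mem_ofPred_eq, Fin.forall_fin_succ (n := k + 1), Fin.cons_zero,
    Fin.cons_succ, Fin.forall_fin_succ (n := k), Fin.castSucc_zero]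
  simp only [← Fin.succ_castSucc, Fin.cons_succ]
  tauto

/-- The recursion behind the induction on length: on `A`, adding a link at the front convolves the
fiber function with the indicator of the first difference set. -/
theorem chainFiber_succ {A : Set V} (hA : MeasurableSet A) {k : ℕ} {s : Fin (k + 1) → Set V}
    (hs : ∀ i, MeasurableSet (s i)) {x : V} (hx : x ∈ A) :
    chainFiber A s x = ∫⁻ y, (s 0).indicator 1 (x - y) * chainFiber A (fun i => s i.succ) y := by
  have h1 : {y : Fin (k + 1) → V | (Fin.cons x y : Fin (k + 2) → V) ∈ diffChains A s} =
      {y | x - y 0 ∈ s 0} ∩ diffChains A (fun i => s i.succ) := by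
    ext y
    simp [cons_mem_diffChains_iff, hx]
  have hm : MeasurableSet ({y : Fin (k + 1) → V | x - y 0 ∈ s 0} ∩
      diffChains A (fun i => s i.succ)) :=
    ((hs 0).preimage (by fun_prop : Measurable fun y : Fin (k + 1) → V => x - y 0)).inter
      (measurableSet_diffChains hA fun i => hs i.succ)
  rw [chainFiber, h1, volume_eq_lintegral_cons hm]
  refine lintegral_congr fun y => ?_
  by_cases hy : x - y ∈ s 0
  · simp [hy, chainFiber]
  · simp [hy]

theorem chainFiber_le {A : Set V} (k : ℕ) (s : Fin k → Set V) (x : V) :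
    chainFiber A s x ≤ volume A ^ k := by
  have : {y : Fin k → V | (Fin.cons x y : Fin (k + 1) → V) ∈ diffChains A s} ⊆
      Set.univ.pi fun _ => A := by
    intro y hy j _
    have := hy.1 j.succ
    simpa using this
  refine (measure_mono this).trans ?_
  rw [volume_pi_pi]
  simp

/-- Each link costs one application of the operator bound, starting from the indicator of `A`, which
is the fiber function of chains without links. -/
theorem lintegral_chainFiber_sq_le {A : Set V} (hA : MeasurableSet A) (hAb : Bornology.IsBounded A)
    {N : ℝ≥0∞} : ∀ {k : ℕ} {s : Fin k → Set V}, (∀ i, MeasurableSet (s i)) →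
      (∀ i, Bornology.IsBounded (s i)) →
      (∀ i, ∀ f : V → ℂ, Integrable f → MemLp f 2 volume → (∀ x, x ∉ A → f x = 0) →
        ∫⁻ x in A, ‖((s i).indicator (fun _ => (1 : ℂ)) ⋆[ContinuousLinearMap.mul ℂ ℂ] f) x‖ₑ ^ 2 ≤
          N ^ 2 * ∫⁻ x, ‖f x‖ₑ ^ 2) →
      ∫⁻ x, chainFiber A s x ^ 2 ≤ (N ^ 2) ^ k * volume A := by
  intro k
  induction k with
  | zero =>
    intro s hs hsb hN
    rw [pow_zero, one_mul, ← lintegral_indicator_one hA]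
    refine lintegral_mono fun x => ?_
    by_cases hx : x ∈ A
    · rw [indicator_of_mem hx]
      have := chainFiber_le (A := A) 0 s x
      rw [pow_zero] at this
      exact pow_le_one₀ zero_le this
    · rw [chainFiber_of_notMem hx]; simp
  | succ k ih =>
    intro s hs hsb hN
    have hvt : volume A ≠ ∞ := hAb.measure_lt_top.ne
    set G := chainFiber A (fun i : Fin k => s i.succ) with hG
    have hGm : Measurable G := measurable_chainFiber hA fun i => hs i.succ
    have hGt : ∀ x, G x ≠ ∞ := fun x =>
      ((chainFiber_le k _ x).trans_lt (ENNReal.pow_lt_top hvt.lt_top)).ne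
    set f : V → ℂ := fun x => ((G x).toReal : ℂ) with hf
    have hfm : Measurable f := Complex.measurable_ofReal.comp hGm.ennreal_toReal
    have hfA : ∀ x, x ∉ A → f x = 0 := fun x hx => by
      simp [hf, hG, chainFiber_of_notMem hx]
    have hfb : ∀ x, ‖f x‖ ≤ (volume A ^ k).toReal := fun x => by
      rw [hf, Complex.norm_real, Real.norm_of_nonneg ENNReal.toReal_nonneg]
      exact ENNReal.toReal_mono (ENNReal.pow_ne_top hvt) (chainFiber_le k _ x)
    have hfe : ∀ x, ‖f x‖ₑ = G x := fun x => by
      rw [← ofReal_norm, hf, Complex.norm_real, Real.norm_of_nonneg ENNReal.toReal_nonneg,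
        ENNReal.ofReal_toReal (hGt x)]
    have hfind : A.indicator f = f := by
      refine indicator_eq_self.2 fun x hx => ?_
      by_contra h
      exact hx (hfA x h)
    have hfin : IsFiniteMeasure (volume.restrict A) := ⟨by simpa using hvt.lt_top⟩
    have hf1 : Integrable f := by
      rw [← hfind, integrable_indicator_iff hA]
      exact (memLp_one_iff_integrable.1
        (MemLp.of_bound hfm.aestronglyMeasurable _ (ae_of_all _ hfb)))
    have hf2 : MemLp f 2 volume := by
      rw [← hfind, memLp_indicator_iff_restrict hA]
      exact MemLp.of_bound hfm.aestronglyMeasurable _ (ae_of_all _ hfb)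
    have hconv : ∀ x, ‖((s 0).indicator (fun _ => (1 : ℂ)) ⋆[ContinuousLinearMap.mul ℂ ℂ] f) x‖ₑ =
        ∫⁻ y, (s 0).indicator 1 (x - y) * G y := by
      intro x
      have hpre : MeasurableSet {y | x - y ∈ s 0} := (hs 0).preimage (by fun_prop)
      have e0 : ∀ y, (ContinuousLinearMap.mul ℂ ℂ) ((s 0).indicator (fun _ => (1 : ℂ)) (x - y)) (f y) =
          (({y | x - y ∈ s 0}.indicator (fun y => (G y).toReal) y : ℝ) : ℂ) := by
        intro y
        by_cases hy : x - y ∈ s 0 <;> simp [hy, hf]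
      have hint : Integrable ({y | x - y ∈ s 0}.indicator fun y => (G y).toReal) := by
        have := hf1.norm.indicator hpre
        refine this.congr (ae_of_all _ fun y => ?_)
        simp [indicator, hf]
      have hnn : 0 ≤ ∫ y, {y | x - y ∈ s 0}.indicator (fun y => (G y).toReal) y :=
        integral_nonneg fun y => indicator_nonneg (fun _ _ => ENNReal.toReal_nonneg) y
      rw [convolution_eq_swap]
      simp_rw [e0]
      rw [integral_complex_ofReal, ← ofReal_norm, Complex.norm_real, Real.norm_of_nonneg hnn,
        ofReal_integral_eq_lintegral_ofReal hint
          (ae_of_all _ fun y => indicator_nonneg (fun _ _ => ENNReal.toReal_nonneg) y)]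
      refine lintegral_congr fun y => ?_
      by_cases hy : x - y ∈ s 0
      · simp [hy, ENNReal.ofReal_toReal (hGt y)]
      · simp [hy]
    have h1 := hN 0 f hf1 hf2 hfA
    simp_rw [hfe, hconv] at h1
    have h2 := ih (s := fun i => s i.succ) (fun i => hs i.succ) (fun i => hsb i.succ)
      (fun i => hN i.succ)
    calc ∫⁻ x, chainFiber A s x ^ 2
        = ∫⁻ x in A, (∫⁻ y, (s 0).indicator 1 (x - y) * G y) ^ 2 := by
          rw [← lintegral_indicator hA]
          refine lintegral_congr fun x => ?_
          by_cases hx : x ∈ A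
          · rw [indicator_of_mem hx, chainFiber_succ hA hs hx]
          · rw [indicator_of_notMem hx, chainFiber_of_notMem hx]; simp
      _ ≤ N ^ 2 * ∫⁻ x, G x ^ 2 := h1
      _ ≤ N ^ 2 * ((N ^ 2) ^ k * volume A) := by gcongr
      _ = _ := by rw [pow_succ]; ring

/-- The volume is the pairing of the fiber function with the indicator of `A`; Cauchy-Schwarz
contributes the two halves of the factor `volume A`. -/
theorem volume_diffChains_le {A : Set V} (hA : MeasurableSet A) (hAb : Bornology.IsBounded A)
    {N : ℝ≥0∞} {k : ℕ} {s : Fin k → Set V} (hs : ∀ i, MeasurableSet (s i))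
    (hsb : ∀ i, Bornology.IsBounded (s i))
    (hN : ∀ i, ∀ f : V → ℂ, Integrable f → MemLp f 2 volume → (∀ x, x ∉ A → f x = 0) →
        ∫⁻ x in A, ‖((s i).indicator (fun _ => (1 : ℂ)) ⋆[ContinuousLinearMap.mul ℂ ℂ] f) x‖ₑ ^ 2 ≤
          N ^ 2 * ∫⁻ x, ‖f x‖ₑ ^ 2) :
    volume (diffChains A s) ≤ N ^ k * volume A := by
  rw [← ENNReal.pow_le_pow_left_iff two_ne_zero]
  have h1 : volume (diffChains A s) = ∫⁻ x, A.indicator 1 x * chainFiber A s x := by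
    rw [volume_diffChains_eq hA hs]
    refine lintegral_congr fun x => ?_
    by_cases hx : x ∈ A
    · simp [hx]
    · simp [chainFiber_of_notMem hx]
  have h2 : ∫⁻ x, (A.indicator 1 x : ℝ≥0∞) ^ 2 = volume A := by
    rw [← lintegral_indicator_one hA]
    refine lintegral_congr fun x => ?_
    by_cases hx : x ∈ A <;> simp [hx]
  calc volume (diffChains A s) ^ 2 ≤ (∫⁻ x, (A.indicator 1 x : ℝ≥0∞) ^ 2) *
        ∫⁻ x, chainFiber A s x ^ 2 := by
        rw [h1]
        exact lintegral_mul_sq_le (aemeasurable_one.indicator hA)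
          (measurable_chainFiber hA hs).aemeasurable
    _ ≤ volume A * ((N ^ 2) ^ k * volume A) := by
        rw [h2]; gcongr; exact lintegral_chainFiber_sq_le hA hAb hs hsb hN
    _ = _ := by ring

end Chains

/-! ### From volumes of neighbourhoods to covering numbers and dimensions. -/

section Dimension

variable {X : Type*} [MetricSpace X] [MeasurableSpace X] [BorelSpace X]

/-- Balls of radius `δ/2` about `δ`-separated points of `A` are disjoint and lie in the
`δ`-neighbourhood. -/
theorem packingNumber_mul_le_measure_thickening (μ : Measure X) {A : Set X} {δ : ℝ≥0} (hδ : 0 < δ)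
    {m : ℝ≥0∞} (hm0 : m ≠ 0) (hmt : m ≠ ∞) (hm : ∀ x, m ≤ μ (Metric.ball x (δ / 2)))
    (hfin : μ (Metric.thickening δ A) ≠ ∞) :
    ((Metric.packingNumber δ A : ℕ∞) : ℝ≥0∞) * m ≤ μ (Metric.thickening δ A) := by
  have h1 : ∀ C : Set X, C ⊆ A → Metric.IsSeparated δ C →
      ((C.encard : ℕ∞) : ℝ≥0∞) * m ≤ μ (Metric.thickening δ A) := by
    intro C hCA hC
    calc ((C.encard : ℕ∞) : ℝ≥0∞) * m = ∑' _ : C, m := by rw [ENNReal.tsum_const]; rfl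
      _ ≤ ∑' x : C, μ (Metric.ball (x : X) (δ / 2)) := ENNReal.tsum_le_tsum fun x => hm x
      _ ≤ μ (⋃ x : C, Metric.ball (x : X) (δ / 2)) := by
          refine tsum_meas_le_meas_iUnion_of_disjoint μ (fun _ => Metric.isOpen_ball.measurableSet)
            fun x y hxy => ?_
          refine Metric.ball_disjoint_ball ?_
          have : (δ : ℝ≥0∞) < edist (x : X) y := hC x.2 y.2 (fun h => hxy (Subtype.ext h))
          have h2 : (δ : ℝ) < dist (x : X) y := by
            rw [edist_nndist] at this
            exact_mod_cast this
          linarith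
      _ ≤ _ := by
          refine measure_mono (iUnion_subset fun x y hy => ?_)
          rw [Metric.mem_thickening_iff]
          have hδ' : (0 : ℝ) < δ := hδ
          exact ⟨x, hCA x.2, by linarith [Metric.mem_ball.1 hy]⟩
  set q := μ (Metric.thickening δ A) / m with hq
  have hqt : q ≠ ∞ := ENNReal.div_ne_top hfin hm0
  -- The packing number is a supremum in `ℕ∞`, so the real bound is rounded down to a natural number
  -- before the supremum is taken.
  have h2 : Metric.packingNumber δ A ≤ (⌊q.toReal⌋₊ : ℕ∞) := by
    refine iSup_le fun C => iSup_le fun hCA => iSup_le fun hC => ?_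
    have h3 : ((C.encard : ℕ∞) : ℝ≥0∞) ≤ q :=
      (ENNReal.le_div_iff_mul_le (Or.inl hm0) (Or.inl hmt)).2 (h1 C hCA hC)
    have h4 : C.encard ≠ ⊤ := by
      intro h
      rw [h] at h3
      exact hqt (top_le_iff.1 h3)
    obtain ⟨N, hN⟩ := ENat.ne_top_iff_exists.1 h4
    rw [← hN] at h3 ⊢
    refine Nat.cast_le.2 (Nat.le_floor ?_)
    have := ENNReal.toReal_mono hqt h3
    simpa using this
  have h5 : ((Metric.packingNumber δ A : ℕ∞) : ℝ≥0∞) ≤ q := by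
    calc ((Metric.packingNumber δ A : ℕ∞) : ℝ≥0∞) ≤ (((⌊q.toReal⌋₊ : ℕ) : ℕ∞) : ℝ≥0∞) :=
          ENat.toENNReal_le.2 h2
      _ = ENNReal.ofReal (⌊q.toReal⌋₊ : ℝ) := by simp
      _ ≤ ENNReal.ofReal q.toReal :=
          ENNReal.ofReal_le_ofReal (Nat.floor_le ENNReal.toReal_nonneg)
      _ = q := ENNReal.ofReal_toReal hqt
  exact (ENNReal.le_div_iff_mul_le (Or.inl hm0) (Or.inl hmt)).1 h5

theorem coveringNumber_le_of_measure_thickening_le {μ : Measure X} {c D : ℝ} (hc : 0 < c)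
    (hμ : ∀ x r, 0 < r → ENNReal.ofReal (c * r ^ D) ≤ μ (Metric.ball x r)) {A : Set X} {δ C b : ℝ}
    (hδ : 0 < δ) (h : μ (Metric.thickening δ A) ≤ ENNReal.ofReal (C * δ ^ (D - b))) :
    ((Metric.coveringNumber δ.toNNReal A : ℕ∞) : ℝ≥0∞) ≤
      ENNReal.ofReal (C * 2 ^ D / c * δ ^ (-b)) := by
  have hco : (δ.toNNReal : ℝ) = δ := Real.coe_toNNReal _ hδ.le
  have hm : 0 < c * (δ / 2) ^ D := by positivity
  have h1 := packingNumber_mul_le_measure_thickening μ (A := A) (Real.toNNReal_pos.2 hδ)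
    (ENNReal.ofReal_pos.2 hm).ne' ENNReal.ofReal_ne_top
    (fun x => by rw [hco]; exact hμ x (δ / 2) (by positivity))
    (by rw [hco]; exact (h.trans_lt ENNReal.ofReal_lt_top).ne)
  rw [hco] at h1
  have h2 := h1.trans h
  rw [← ENNReal.le_div_iff_mul_le (Or.inl (ENNReal.ofReal_pos.2 hm).ne')
    (Or.inl ENNReal.ofReal_ne_top), ← ENNReal.ofReal_div_of_pos hm] at h2
  refine (ENat.toENNReal_le.2 (Metric.coveringNumber_le_packingNumber _ _)).trans (h2.trans
    (le_of_eq ?_))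
  congr 1
  rw [Real.div_rpow hδ.le (by norm_num), Real.rpow_sub hδ, Real.rpow_neg hδ.le]
  field_simp

/-- Covers along a single sequence of scales already bound the Hausdorff measure, which is why
regularity along `δ_i` is enough. -/
theorem dimH_le_of_coveringNumber_le {A : Set X} {δ : ℕ → ℝ} (hδ : ∀ i, 0 < δ i)
    (hδ0 : Tendsto δ atTop (𝓝 0)) {C b : ℝ} (hb : 0 ≤ b)
    (h : ∀ᶠ i in atTop, ((Metric.coveringNumber (δ i).toNNReal A : ℕ∞) : ℝ≥0∞) ≤
      ENNReal.ofReal (C * δ i ^ (-b))) : dimH A ≤ ENNReal.ofReal b := by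
  have hfin : ∀ i, Fintype (Metric.minimalCover (δ i).toNNReal A) := fun i =>
    Metric.finite_minimalCover.fintype
  have hle : μH[b] A ≤ ENNReal.ofReal (C * 2 ^ b) := by
    refine (Measure.hausdorffMeasure_le_liminf_sum b A (l := atTop)
      (fun i => ENNReal.ofReal (2 * δ i)) ?_
      (fun i (x : Metric.minimalCover (δ i).toNNReal A) => Metric.closedBall (x : X) (δ i))
      (Eventually.of_forall fun i x => ?_) ?_).trans ?_
    · have := (hδ0.const_mul 2)
      rw [mul_zero] at this
      simpa only [ENNReal.ofReal_zero, Function.comp_def] using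
        (ENNReal.continuous_ofReal.tendsto _).comp this
    · refine Metric.ediam_le_of_forall_dist_le fun y hy z hz => ?_
      linarith [dist_triangle_right y z (x : X), Metric.mem_closedBall.1 hy,
        Metric.mem_closedBall.1 hz]
    · filter_upwards [h] with i hi
      have ht : Metric.coveringNumber (δ i).toNNReal A ≠ ⊤ := by
        intro h'
        rw [h'] at hi
        exact ENNReal.ofReal_ne_top (top_le_iff.1 hi)
      have := (Metric.isCover_minimalCover ht).subset_iUnion_closedBall
      rw [Real.coe_toNNReal _ (hδ i).le] at this
      rwa [← iUnion_subtype (p := fun y => y ∈ Metric.minimalCover (δ i).toNNReal A)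
        (fun y => Metric.closedBall (y : X) (δ i))] at this
    · refine liminf_le_of_frequently_le' (Eventually.frequently ?_)
      filter_upwards [h] with i hi
      have ht : Metric.coveringNumber (δ i).toNNReal A ≠ ⊤ := by
        intro h'
        rw [h'] at hi
        exact ENNReal.ofReal_ne_top (top_le_iff.1 hi)
      have hδi := hδ i
      calc ∑ x : Metric.minimalCover (δ i).toNNReal A,
            Metric.ediam (Metric.closedBall (x : X) (δ i)) ^ b
          ≤ ∑ x : Metric.minimalCover (δ i).toNNReal A, ENNReal.ofReal (2 * δ i) ^ b := by
            refine Finset.sum_le_sum fun x _ => ENNReal.rpow_le_rpow ?_ hb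
            refine Metric.ediam_le_of_forall_dist_le fun y hy z hz => ?_
            linarith [dist_triangle_right y z (x : X), Metric.mem_closedBall.1 hy,
              Metric.mem_closedBall.1 hz]
        _ = ((Metric.coveringNumber (δ i).toNNReal A : ℕ∞) : ℝ≥0∞) * ENNReal.ofReal (2 * δ i) ^ b := by
            rw [Finset.sum_const, ← Metric.encard_minimalCover ht, Finset.card_univ, nsmul_eq_mul,
              ← Set.coe_fintypeCard, ENat.toENNReal_coe]
        _ ≤ ENNReal.ofReal (C * δ i ^ (-b)) * ENNReal.ofReal (2 * δ i) ^ b := by gcongr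
        _ = ENNReal.ofReal (C * 2 ^ b) := by
            rw [ENNReal.ofReal_rpow_of_pos (by positivity), ← ENNReal.ofReal_mul' (by positivity),
              Real.mul_rpow (by norm_num) hδi.le, Real.rpow_neg hδi.le]
            congr 1
            have : δ i ^ b ≠ 0 := (Real.rpow_pos_of_pos hδi b).ne'
            field_simp
  have hne : μH[(b.toNNReal : ℝ)] A ≠ ∞ := by
    rw [Real.coe_toNNReal b hb]
    exact (hle.trans_lt ENNReal.ofReal_lt_top).ne
  exact dimH_le_of_hausdorffMeasure_ne_top hne

theorem lowerMinkowskiDim_le_of_coveringNumber_le {A : Set X} {δ : ℕ → ℝ} (hδ : ∀ i, 0 < δ i)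
    (hδ0 : Tendsto δ atTop (𝓝 0)) {C b b' : ℝ} (hb : b < b')
    (h : ∀ᶠ i in atTop, ((Metric.coveringNumber (δ i).toNNReal A : ℕ∞) : ℝ≥0∞) ≤
      ENNReal.ofReal (C * δ i ^ (-b))) : lowerMinkowskiDim A ≤ (b' : EReal) := by
  have htend : Tendsto (fun i => (δ i).toNNReal) atTop (𝓝[>] 0) := by
    refine tendsto_nhdsWithin_iff.2 ⟨?_, Eventually.of_forall fun i => Real.toNNReal_pos.2 (hδ i)⟩
    have := (continuous_real_toNNReal.tendsto 0).comp hδ0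
    rwa [Real.toNNReal_zero] at this
  refine liminf_le_of_frequently_le' (htend.frequently (Eventually.frequently ?_))
  have hδp : Tendsto δ atTop (𝓝[>] 0) :=
    tendsto_nhdsWithin_iff.2 ⟨hδ0, Eventually.of_forall hδ⟩
  -- The constant is absorbed into the slack between `b` and `b'`.
  have hpow : ∀ᶠ i in atTop, C ≤ δ i ^ (-(b' - b)) :=
    ((tendsto_rpow_neg_nhdsGT_zero (by linarith)).comp hδp).eventually_ge_atTop C
  have hlt : ∀ᶠ i in atTop, δ i < 1 := hδ0.eventually_lt_const one_pos
  filter_upwards [h, hpow, hlt] with i h1 h2 h3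
  have hδi := hδ i
  have hlog : 0 < Real.log (1 / δ i) := Real.log_pos (by rw [lt_div_iff₀ hδi]; linarith)
  rw [Real.coe_toNNReal _ hδi.le,
    EReal.div_le_iff_le_mul (by exact_mod_cast hlog) (EReal.coe_ne_top _)]
  have h4 : ((Metric.externalCoveringNumber (δ i).toNNReal A : ℕ∞) : ℝ≥0∞) ≤
      ENNReal.ofReal (δ i ^ (-b')) := by
    refine (ENat.toENNReal_le.2 (Metric.externalCoveringNumber_le_coveringNumber _ _)).trans
      (h1.trans (ENNReal.ofReal_le_ofReal ?_))
    calc C * δ i ^ (-b) ≤ δ i ^ (-(b' - b)) * δ i ^ (-b) := by gcongr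
      _ = δ i ^ (-b') := by rw [← Real.rpow_add hδi]; ring_nf
  refine (ENNReal.log_le_log h4).trans (le_of_eq ?_)
  rw [ENNReal.log_ofReal_of_pos (by positivity), Real.log_rpow hδi, one_div, Real.log_inv,
    ← EReal.coe_mul]
  congr 1
  ring

/-- Upper bounds for the lower Minkowski and the Hausdorff dimension in terms of the volumes of
neighbourhoods along a sequence of scales. -/
theorem dimension_le_of_measure_thickening_le {μ : Measure X} {c D : ℝ} (hc : 0 < c)
    (hμ : ∀ x r, 0 < r → ENNReal.ofReal (c * r ^ D) ≤ μ (Metric.ball x r)) {A : Set X} {β : ℝ}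
    (hβ : 0 ≤ β) {δ : ℕ → ℝ} (hδ : ∀ i, 0 < δ i) (hδ0 : Tendsto δ atTop (𝓝 0))
    (h : ∀ b, β < b → ∃ C, ∀ᶠ i in atTop,
      μ (Metric.thickening (δ i) A) ≤ ENNReal.ofReal (C * δ i ^ (D - b))) :
    lowerMinkowskiDim A ≤ (β : EReal) ∧ dimH A ≤ ENNReal.ofReal β := by
  have hcov : ∀ b, β < b → ∃ C, ∀ᶠ i in atTop,
      ((Metric.coveringNumber (δ i).toNNReal A : ℕ∞) : ℝ≥0∞) ≤ ENNReal.ofReal (C * δ i ^ (-b)) := by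
    intro b hb
    obtain ⟨C, hC⟩ := h b hb
    exact ⟨_, hC.mono fun i hi => coveringNumber_le_of_measure_thickening_le hc hμ (hδ i) hi⟩
  constructor
  · refine EReal.le_of_forall_lt_iff_le.1 fun z hz => ?_
    obtain ⟨b, hb1, hb2⟩ := exists_between (EReal.coe_lt_coe_iff.1 hz)
    obtain ⟨C, hC⟩ := hcov b hb1
    exact lowerMinkowskiDim_le_of_coveringNumber_le hδ hδ0 hb2 hC
  · refine ENNReal.le_of_forall_pos_le_add fun ε hε _ => ?_
    have hε' : (0 : ℝ) < ε := hε
    obtain ⟨C, hC⟩ := hcov (β + ε) (by linarith)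
    refine (dimH_le_of_coveringNumber_le hδ hδ0 (by linarith) hC).trans ?_
    rw [ENNReal.ofReal_add hβ hε'.le, ENNReal.ofReal_coe_nnreal]

end Dimension

/-! ### Upper bounds for the dimension of chain sets. -/

section UpperBound

/-- Moving two vertices by less than `δ` each changes their distance by less than `2δ`. Distinctness
of the vertices is simply dropped. -/
theorem thickening_chainSet_subset {n k : ℕ} (t : Fin k → ℝ)
    (E : Set (EuclideanSpace ℝ (Fin (n + 1)))) (δ : ℝ) :
    Metric.thickening δ (chainSet t E) ⊆
      diffChains (Metric.thickening δ E) (fun i => shell n (t i) δ) := by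
  intro z hz
  obtain ⟨x, ⟨hxE, hxt, -⟩, hzx⟩ := Metric.mem_thickening_iff.1 hz
  have hj : ∀ j, dist (z j) (x j) < δ := fun j => (dist_le_pi_dist z x j).trans_lt hzx
  refine ⟨fun j => Metric.mem_thickening_iff.2 ⟨x j, hxE j, hj j⟩, fun i => ?_⟩
  have h1 := hj i.castSucc
  have h2 := hj i.succ
  have h3 := hxt i
  have h4 := dist_triangle4 (z i.castSucc) (x i.castSucc) (x i.succ) (z i.succ)
  have h5 := dist_triangle4 (x i.castSucc) (z i.castSucc) (z i.succ) (x i.succ)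
  rw [dist_comm (x i.castSucc) (z i.castSucc)] at h5
  rw [dist_comm (x i.succ) (z i.succ)] at h4
  simp only [shell, Set.mem_sdiff, mem_closedBall_zero_iff, ← dist_eq_norm, not_le]
  constructor <;> linarith

theorem ofReal_le_volume_ball_pi (n k : ℕ) : ∃ c : ℝ, 0 < c ∧
    ∀ (x : Fin (k + 1) → EuclideanSpace ℝ (Fin (n + 1))) (r : ℝ), 0 < r →
      ENNReal.ofReal (c * r ^ (((n : ℝ) + 1) * (k + 1))) ≤ volume (Metric.ball x r) := by
  set v := volume.real (Metric.ball (0 : EuclideanSpace ℝ (Fin (n + 1))) 1) with hv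
  have hvt : volume (Metric.ball (0 : EuclideanSpace ℝ (Fin (n + 1))) 1) ≠ ∞ :=
    Metric.isBounded_ball.measure_lt_top.ne
  have hv0 : 0 < v := ENNReal.toReal_pos (Metric.measure_ball_pos volume _ one_pos).ne' hvt
  refine ⟨v ^ (k + 1), by positivity, fun x r hr => le_of_eq ?_⟩
  rw [ball_pi x hr, volume_pi_pi]
  have : ∀ i, volume (Metric.ball (x i) r) = ENNReal.ofReal (r ^ (n + 1) * v) := by
    intro i
    rw [Measure.addHaar_ball _ _ hr.le, finrank_euclideanSpace_fin,
      ENNReal.ofReal_mul (by positivity), hv, Measure.real, ENNReal.ofReal_toReal hvt]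
  simp_rw [this]
  rw [Finset.prod_const, Finset.card_univ, Fintype.card_fin, ← ENNReal.ofReal_pow (by positivity),
    mul_pow, ← pow_mul, ← Real.rpow_natCast r]
  push_cast
  rw [mul_comm]

/-- The upper bounds for the dimension of chain sets. -/
theorem dimension_chainSet_le {n k : ℕ} {t : Fin k → ℝ} (ht : ∀ i, 0 < t i) {α γ : ℝ}
    (hγ0 : 0 ≤ γ) (hγ : ((n : ℝ) + 2) / 2 - α ≤ γ)
    {E : Set (EuclideanSpace ℝ (Fin (n + 1)))} (hE : Bornology.IsBounded E)
    (hreg : IsDiscreteRegular E α) (hβ : 0 ≤ ((k : ℝ) + 1) * α - k + k * γ) :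
    lowerMinkowskiDim (chainSet t E) ≤ ((((k : ℝ) + 1) * α - k + k * γ : ℝ) : EReal) ∧
      dimH (chainSet t E) ≤ ENNReal.ofReal (((k : ℝ) + 1) * α - k + k * γ) := by
  obtain ⟨δ, hδ, hδ0, ε₀, hε₀, hreg⟩ := hreg
  obtain ⟨c, hc, hball⟩ := ofReal_le_volume_ball_pi n k
  refine dimension_le_of_measure_thickening_le hc hball hβ hδ hδ0 fun b hb => ?_
  set β := ((k : ℝ) + 1) * α - k + k * γ with hβdef
  -- The total loss in the exponent is `(2k + 2)ε`: `2ε` from each of the `k` operators and `2ε`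
  -- from the volume of `A`.
  set ε := min (ε₀ / 2) ((b - β) / (2 * k + 2)) with hε
  have hε0 : 0 < ε := lt_min (by linarith) (div_pos (by linarith) (by positivity))
  have hε1 : ε < ε₀ := (min_le_left _ _).trans_lt (by linarith)
  have hε2 : (2 * k + 2) * ε ≤ b - β := by
    have : ε ≤ (b - β) / (2 * k + 2) := min_le_right _ _
    rw [le_div_iff₀ (by positivity)] at this
    linarith
  obtain ⟨C, hC, hCE⟩ := hreg ε hε0 hε1
  choose C' hC'0 hC' using fun i =>
    exists_shell_convolution_bound n (ht i) hC hε0 hγ0 hγ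
  obtain ⟨R₀, hR₀⟩ := hE.subset_ball 0
  set R := max R₀ 0 + 1 with hR
  have hR1 : 1 ≤ R := by rw [hR]; linarith [le_max_right R₀ 0]
  -- One constant serving all gaps; the sum makes sense also when there are none.
  set M := ∑ i, C' i with hM
  have hM0 : 0 ≤ M := Finset.sum_nonneg fun i _ => (hC'0 i).le
  refine ⟨M ^ k * (C * R ^ (α + ε)), ?_⟩
  have h1 : ∀ᶠ i in atTop, δ i < 1 := hδ0.eventually_lt_const one_pos
  have h2 : ∀ᶠ i in atTop, ∀ j, δ i < t j / 4 :=
    eventually_all.2 fun j => hδ0.eventually_lt_const (by linarith [ht j])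
  filter_upwards [h1, h2] with i hi1 hi2
  have hδi := hδ i
  set A := Metric.thickening (δ i) E with hA
  have hAm : MeasurableSet A := Metric.isOpen_thickening.measurableSet
  have hAR : A ⊆ Metric.ball 0 R := by
    intro x hx
    obtain ⟨y, hy, hxy⟩ := Metric.mem_thickening_iff.1 hx
    have := Metric.mem_ball.1 (hR₀ hy)
    rw [Metric.mem_ball, hR]
    linarith [dist_triangle x y 0, le_max_left R₀ 0]
  have hAb : Bornology.IsBounded A := Metric.isBounded_ball.subset hAR
  set T := δ i ^ ((n : ℝ) + 2 - α - γ - 2 * ε) with hT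
  have hT0 : 0 < T := by positivity
  have hvol := volume_diffChains_le hAm hAb (N := ENNReal.ofReal (M * T))
    (s := fun j => shell n (t j) (δ i)) (fun j => measurableSet_shell n _ _)
    (fun j => isBounded_shell n _ _) (fun j f hf hf2 hfA => by
      refine (hC' j (δ i) hδi hi1.le (hi2 j).le A hAm ?_ f hf hf2 hfA).trans ?_
      · exact fun x r hr => hCE i x r hr
      · gcongr
        exact Finset.single_le_sum (fun j _ => (hC'0 j).le) (Finset.mem_univ j))
  have hvA : volume A ≤ ENNReal.ofReal (C * (R / δ i) ^ (α + ε) * δ i ^ (((n + 1 : ℕ) : ℝ) - ε)) := by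
    have := hCE i 0 R (by linarith)
    rwa [inter_eq_left.2 hAR] at this
  calc volume (Metric.thickening (δ i) (chainSet t E))
      ≤ volume (diffChains A fun j => shell n (t j) (δ i)) :=
        measure_mono (thickening_chainSet_subset t E (δ i))
    _ ≤ ENNReal.ofReal (M * T) ^ k *
        ENNReal.ofReal (C * (R / δ i) ^ (α + ε) * δ i ^ (((n + 1 : ℕ) : ℝ) - ε)) := by
        refine hvol.trans ?_
        gcongr
    _ = ENNReal.ofReal ((M * T) ^ k *
        (C * (R / δ i) ^ (α + ε) * δ i ^ (((n + 1 : ℕ) : ℝ) - ε))) := by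
        rw [← ENNReal.ofReal_pow (by positivity), ← ENNReal.ofReal_mul (by positivity)]
    _ ≤ _ := by
        refine ENNReal.ofReal_le_ofReal ?_
        have e1 : (R / δ i) ^ (α + ε) = R ^ (α + ε) * δ i ^ (-(α + ε)) := by
          rw [Real.div_rpow (by positivity) hδi.le, Real.rpow_neg hδi.le, div_eq_mul_inv]
        have e2 : T ^ k = δ i ^ (((n : ℝ) + 2 - α - γ - 2 * ε) * k) := by
          rw [hT, ← Real.rpow_natCast, ← Real.rpow_mul hδi.le]
        calc (M * T) ^ k * (C * (R / δ i) ^ (α + ε) * δ i ^ (((n + 1 : ℕ) : ℝ) - ε))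
            = M ^ k * (C * R ^ (α + ε)) * (δ i ^ (((n : ℝ) + 2 - α - γ - 2 * ε) * k) *
              δ i ^ (-(α + ε)) * δ i ^ (((n + 1 : ℕ) : ℝ) - ε)) := by
              rw [mul_pow, e1, e2]; ring
          _ = M ^ k * (C * R ^ (α + ε)) *
              δ i ^ (((n : ℝ) + 1) * (k + 1) - β - (2 * k + 2) * ε) := by
              rw [← Real.rpow_add hδi, ← Real.rpow_add hδi]
              congr 2
              rw [hβdef]; push_cast; ring
          _ ≤ _ := by
              refine mul_le_mul_of_nonneg_left ?_ (by positivity)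
              exact Real.rpow_le_rpow_of_exponent_ge hδi hi1.le (by linarith)

end UpperBound

/-! ### Ahlfors regular measures on intervals and Cantor sets. -/

section Cantor

/-- Ahlfors regularity of a measure carried by a set. -/
structure IsAhlforsRegular {X : Type*} [PseudoMetricSpace X] [MeasurableSpace X] (μ : Measure X)
    (E : Set X) (s : ℝ) : Prop where
  measure_compl : μ Eᶜ = 0
  exists_upper : ∃ C : ℝ, 0 < C ∧ ∀ x r, 0 < r → μ (Metric.closedBall x r) ≤ ENNReal.ofReal (C * r ^ s)
  exists_lower : ∃ c : ℝ, 0 < c ∧ ∀ x ∈ E, ∀ r, 0 < r → r ≤ 1 →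
    ENNReal.ofReal (c * r ^ s) ≤ μ (Metric.ball x r)

theorem isAhlforsRegular_Icc {L : ℝ} (hL : 0 < L) :
    IsAhlforsRegular (volume.restrict (Icc 0 L)) (Icc 0 L) 1 := by
  refine ⟨?_, ⟨2, two_pos, fun x r hr => ?_⟩, ⟨min 1 L, lt_min one_pos hL, fun x hx r hr hr1 => ?_⟩⟩
  · rw [Measure.restrict_apply measurableSet_Icc.compl]; simp
  · refine (Measure.restrict_apply_le _ _).trans ?_
    rw [Real.volume_closedBall, Real.rpow_one]
  · rw [Measure.restrict_apply Metric.isOpen_ball.measurableSet, Real.rpow_one]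
    have hsub : Ioo (max 0 (x - r)) (min L (x + r)) ⊆ Metric.ball x r ∩ Icc 0 L := by
      intro y hy
      obtain ⟨h1, h2⟩ := hy
      rw [max_lt_iff] at h1
      rw [lt_min_iff] at h2
      refine ⟨?_, h1.1.le, h2.1.le⟩
      rw [Metric.mem_ball, Real.dist_eq, abs_lt]
      constructor <;> linarith
    refine le_trans ?_ (measure_mono hsub)
    rw [Real.volume_Ioo]
    refine ENNReal.ofReal_le_ofReal ?_
    have h1 : min 1 L * r ≤ r := by
      have := min_le_left 1 L
      nlinarith
    have h2 : min 1 L * r ≤ L := by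
      have := min_le_right 1 L
      have h0 : 0 < min 1 L := lt_min one_pos hL
      nlinarith
    obtain ⟨hx0, hxL⟩ := hx
    rcases le_total L (x + r) with h3 | h3 <;> rcases le_total 0 (x - r) with h4 | h4 <;>
      simp only [min_eq_left h3, min_eq_right h3, max_eq_left h4, max_eq_right h4] <;> linarith

theorem IsAhlforsRegular.map_homeomorph {X Y : Type*} [MetricSpace X] [MeasurableSpace X]
    [BorelSpace X] [MetricSpace Y] [MeasurableSpace Y] [BorelSpace Y] {μ : Measure X} {E : Set X}
    {s : ℝ} (h : IsAhlforsRegular μ E s) (e : X ≃ₜ Y) {κ : ℝ} (hκ : 1 ≤ κ)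
    (he : ∀ x y, dist (e x) (e y) ≤ κ * dist x y) (he' : ∀ x y, dist x y ≤ κ * dist (e x) (e y)) :
    IsAhlforsRegular (μ.map e) (e '' E) s := by
  have hκ0 : 0 < κ := one_pos.trans_le hκ
  have hemb : MeasurableEmbedding e := e.measurableEmbedding
  obtain ⟨C, hC, hup⟩ := h.exists_upper
  obtain ⟨c, hc, hlow⟩ := h.exists_lower
  refine ⟨?_, ⟨C * κ ^ s, by positivity, fun y r hr => ?_⟩, ⟨c * (κ⁻¹) ^ s, by positivity, ?_⟩⟩
  · rw [hemb.map_apply, preimage_compl, preimage_image_eq _ hemb.injective, h.measure_compl]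
  · rw [hemb.map_apply]
    have hsub : e ⁻¹' Metric.closedBall y r ⊆ Metric.closedBall (e.symm y) (κ * r) := by
      intro x hx
      refine (he' x (e.symm y)).trans (mul_le_mul_of_nonneg_left ?_ hκ0.le)
      rwa [e.apply_symm_apply]
    refine (measure_mono hsub).trans ((hup _ _ (by positivity)).trans (le_of_eq ?_))
    rw [Real.mul_rpow hκ0.le hr.le, mul_assoc]
  · rintro _ ⟨x, hx, rfl⟩ r hr hr1
    rw [hemb.map_apply]
    have hsub : Metric.ball x (κ⁻¹ * r) ⊆ e ⁻¹' Metric.ball (e x) r := by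
      intro y hy
      refine (he y x).trans_lt ?_
      rw [← lt_div_iff₀' hκ0, div_eq_inv_mul]
      exact hy
    refine le_trans (le_of_eq ?_) ((hlow x hx _ (by positivity) ?_).trans (measure_mono hsub))
    · rw [Real.mul_rpow (by positivity) hr.le, mul_assoc]
    · exact mul_le_one₀ (inv_le_one_of_one_le₀ hκ) hr.le hr1

/-- The coding map of the symmetric Cantor set of ratio `l`. -/
noncomputable def cantorMap (l : ℝ) (b : ℕ → Bool) : ℝ :=
  ∑' n, (if b n then (1 - l) else 0) * l ^ n

section
variable {l : ℝ}

theorem cantor_term_bound (hl0 : 0 < l) (hl1 : l < 1) (b : ℕ → Bool) (n : ℕ) :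
    0 ≤ (if b n then (1 - l) else 0) * l ^ n ∧ (if b n then (1 - l) else 0) * l ^ n ≤ (1 - l) * l ^ n := by
  have h1 : 0 < 1 - l := by linarith
  have h2 : 0 < (1 - l) * l ^ n := by positivity
  split_ifs
  · exact ⟨h2.le, le_rfl⟩
  · rw [zero_mul]; exact ⟨le_rfl, h2.le⟩

theorem summable_cantor (hl0 : 0 < l) (hl1 : l < 1) (b : ℕ → Bool) :
    Summable fun n => (if b n then (1 - l) else 0) * l ^ n :=
  Summable.of_nonneg_of_le (fun n => (cantor_term_bound hl0 hl1 b n).1)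
    (fun n => (cantor_term_bound hl0 hl1 b n).2)
    ((summable_geometric_of_lt_one hl0.le hl1).mul_left _)

theorem cantorMap_mem_Icc (hl0 : 0 < l) (hl1 : l < 1) (b : ℕ → Bool) :
    cantorMap l b ∈ Icc (0 : ℝ) 1 := by
  constructor
  · exact tsum_nonneg fun n => (cantor_term_bound hl0 hl1 b n).1
  · calc cantorMap l b ≤ ∑' n : ℕ, (1 - l) * l ^ n :=
        (summable_cantor hl0 hl1 b).tsum_le_tsum (fun n => (cantor_term_bound hl0 hl1 b n).2)
          ((summable_geometric_of_lt_one hl0.le hl1).mul_left _)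
      _ = 1 := by
        rw [tsum_mul_left, tsum_geometric_of_lt_one hl0.le hl1, mul_inv_cancel₀ (by linarith)]

theorem continuous_cantorMap (hl0 : 0 < l) (hl1 : l < 1) : Continuous (cantorMap l) := by
  refine continuous_tsum (u := fun n => (1 - l) * l ^ n) (fun n => ?_)
    ((summable_geometric_of_lt_one hl0.le hl1).mul_left _) fun n b => ?_
  · have : Continuous fun c : Bool => (if c then (1 - l) else 0) * l ^ n := continuous_of_discreteTopology
    exact this.comp (continuous_apply n)
  · rw [Real.norm_of_nonneg (cantor_term_bound hl0 hl1 b n).1]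
    exact (cantor_term_bound hl0 hl1 b n).2

theorem cantorMap_eq (hl0 : 0 < l) (hl1 : l < 1) (b : ℕ → Bool) :
    cantorMap l b = (if b 0 then (1 - l) else 0) + l * cantorMap l (fun n => b (n + 1)) := by
  rw [cantorMap, (summable_cantor hl0 hl1 b).tsum_eq_zero_add, cantorMap, ← tsum_mul_left]
  simp only [pow_zero, mul_one, pow_succ]
  congr 2
  ext n
  ring

theorem abs_cantorMap_sub_le (hl0 : 0 < l) (hl1 : l < 1) (n : ℕ) :
    ∀ b b' : ℕ → Bool, (∀ i < n, b i = b' i) → |cantorMap l b - cantorMap l b'| ≤ l ^ n := by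
  induction n with
  | zero =>
    intro b b' _
    obtain ⟨h1, h2⟩ := cantorMap_mem_Icc hl0 hl1 b
    obtain ⟨h3, h4⟩ := cantorMap_mem_Icc hl0 hl1 b'
    rw [pow_zero, abs_le]
    constructor <;> linarith
  | succ n ih =>
    intro b b' h
    have h1 := ih (fun n => b (n + 1)) (fun n => b' (n + 1)) fun i hi => h (i + 1) (by omega)
    rw [cantorMap_eq hl0 hl1 b, cantorMap_eq hl0 hl1 b', h 0 (by omega), add_sub_add_left_eq_sub,
      ← mul_sub, abs_mul, abs_of_pos hl0, pow_succ, mul_comm]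
    gcongr

/-- The two halves of the Cantor set are separated by a gap of length `1 - 2l`, so sufficiently
close points share their first digit; self-similarity gives the next ones. -/
theorem eq_of_abs_cantorMap_sub_le (hl0 : 0 < l) (hl1 : l < 1 / 2) (n : ℕ) :
    ∀ b b' : ℕ → Bool, |cantorMap l b - cantorMap l b'| ≤ (1 - 2 * l) * l ^ n →
      ∀ i < n, b i = b' i := by
  have hl1' : l < 1 := by linarith
  induction n with
  | zero => intro b b' _ i hi; omega
  | succ n ih =>
    intro b b' h
    have hpow : (1 - 2 * l) * l ^ (n + 1) < 1 - 2 * l := by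
      have : l ^ (n + 1) < 1 := pow_lt_one₀ hl0.le hl1' (by omega)
      nlinarith
    have h0 : b 0 = b' 0 := by
      by_contra hne
      have hlt := h.trans_lt hpow
      rw [cantorMap_eq hl0 hl1' b, cantorMap_eq hl0 hl1' b', abs_lt] at hlt
      obtain ⟨h1, h2⟩ := cantorMap_mem_Icc hl0 hl1' (fun n => b (n + 1))
      obtain ⟨h3, h4⟩ := cantorMap_mem_Icc hl0 hl1' (fun n => b' (n + 1))
      cases hb : b 0 <;> cases hb' : b' 0
      · exact hne (hb.trans hb'.symm)
      · rw [hb, hb'] at hlt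
        simp only [Bool.false_eq_true, if_false, if_true] at hlt
        nlinarith [hlt.1]
      · rw [hb, hb'] at hlt
        simp only [Bool.false_eq_true, if_false, if_true] at hlt
        nlinarith [hlt.2]
      · exact hne (hb.trans hb'.symm)
    have htail : |cantorMap l (fun n => b (n + 1)) - cantorMap l (fun n => b' (n + 1))| ≤
        (1 - 2 * l) * l ^ n := by
      rw [cantorMap_eq hl0 hl1' b, cantorMap_eq hl0 hl1' b', h0, add_sub_add_left_eq_sub,
        ← mul_sub, abs_mul, abs_of_pos hl0, pow_succ, ← mul_assoc, mul_comm l] at h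
      exact le_of_mul_le_mul_right h hl0
    intro i hi
    rcases i with _ | i
    · exact h0
    · exact ih _ _ htail i (by omega)

/-- The distribution of a sequence of fair coin tosses. -/
noncomputable def coinMeasure : Measure (ℕ → Bool) :=
  Measure.infinitePi fun _ => (PMF.uniformOfFintype Bool).toMeasure

instance isProbabilityMeasure_coinMeasure : IsProbabilityMeasure coinMeasure := by
  unfold coinMeasure; infer_instance

theorem coinMeasure_cylinder (b : ℕ → Bool) (n : ℕ) :
    coinMeasure {b' | ∀ i < n, b' i = b i} = ENNReal.ofReal ((1 / 2) ^ n) := by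
  have : {b' : ℕ → Bool | ∀ i < n, b' i = b i} = Set.pi (Finset.range n) fun i => {b i} := by
    ext b'; simp
  rw [this, coinMeasure, Measure.infinitePi_pi _ fun i _ => measurableSet_singleton _]
  have : ∀ i, (PMF.uniformOfFintype Bool).toMeasure {b i} = ENNReal.ofReal (1 / 2) := by
    intro i
    rw [PMF.toMeasure_apply_singleton _ _ (measurableSet_singleton _), PMF.uniformOfFintype_apply]
    simp [ENNReal.ofReal_inv_of_pos]
  simp_rw [this]
  rw [Finset.prod_const, Finset.card_range, ENNReal.ofReal_pow (by norm_num)]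

/-- Symmetric Cantor sets carry Ahlfors regular measures. -/
theorem exists_isAhlforsRegular_unit {s : ℝ} (hs0 : 0 < s) (hs1 : s ≤ 1) :
    ∃ (K : Set ℝ) (μ : Measure ℝ), IsCompact K ∧ K ⊆ Icc 0 1 ∧ K.Nonempty ∧ IsFiniteMeasure μ ∧
      IsAhlforsRegular μ K s := by
  -- For `s = 1` the ratio would be `1/2` and the gap would close, so the interval is used instead.
  rcases eq_or_lt_of_le hs1 with rfl | hs1
  · exact ⟨Icc 0 1, _, isCompact_Icc, Subset.rfl, nonempty_Icc.2 zero_le_one,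
      ⟨by simp⟩, isAhlforsRegular_Icc one_pos⟩
  -- Chosen so that `l^s = 1/2`: a cylinder of depth `n`, with image of diameter at most `l^n`, has
  -- mass `2^(-n) = (l^n)^s`.
  set l : ℝ := (1 / 2) ^ (1 / s) with hl
  have hl0 : 0 < l := by positivity
  have hlh : l < 1 / 2 := by
    have : (1 / 2 : ℝ) ^ (1 / s) < (1 / 2) ^ (1 : ℝ) :=
      Real.rpow_lt_rpow_of_exponent_gt (by norm_num) (by norm_num) (by rw [lt_div_iff₀ hs0]; linarith)
    rwa [Real.rpow_one] at this
  have hl1 : l < 1 := by linarith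
  have hls : ∀ n : ℕ, (l ^ n) ^ s = (1 / 2 : ℝ) ^ n := by
    intro n
    rw [← Real.rpow_natCast, ← Real.rpow_mul hl0.le, hl, ← Real.rpow_mul (by norm_num),
      ← Real.rpow_natCast]
    congr 1
    field_simp
  have hF := continuous_cantorMap hl0 hl1
  have hK : IsCompact (range (cantorMap l)) := isCompact_range hF
  refine ⟨range (cantorMap l), coinMeasure.map (cantorMap l), hK, ?_, range_nonempty _,
    Measure.isFiniteMeasure_map _ _, ?_, ?_, ?_⟩
  · rintro _ ⟨b, rfl⟩
    exact cantorMap_mem_Icc hl0 hl1 b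
  · rw [Measure.map_apply hF.measurable hK.isClosed.measurableSet.compl, preimage_compl,
      preimage_range, compl_univ, measure_empty]
  · have hgap : 0 < 1 - 2 * l := by linarith
    refine ⟨2 * (2 / (1 - 2 * l)) ^ s, by positivity, fun x r hr => ?_⟩
    rw [Measure.map_apply hF.measurable Metric.isClosed_closedBall.measurableSet]
    -- Two points of the ball are within `2r = (1 - 2l) y`, so if `y ≤ l^n` they share their first
    -- `n` digits.
    set y := 2 * r / (1 - 2 * l) with hy
    have hy0 : 0 < y := by positivity
    have hyr : 2 * (2 / (1 - 2 * l)) ^ s * r ^ s = 2 * y ^ s := by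
      rw [mul_assoc, ← Real.mul_rpow (by positivity) hr.le, hy]
      ring_nf
    rw [hyr]
    rcases eq_empty_or_nonempty (cantorMap l ⁻¹' Metric.closedBall x r) with h | ⟨b, hb⟩
    · rw [h]; simp
    rcases le_total 1 y with h1 | h1
    · refine prob_le_one.trans ?_
      rw [ENNReal.one_le_ofReal]
      have : 1 ≤ y ^ s := Real.one_le_rpow h1 hs0.le
      linarith
    · obtain ⟨n, hn1, hn2⟩ := exists_nat_pow_near_of_lt_one hy0 h1 hl0 hl1
      have hsub : cantorMap l ⁻¹' Metric.closedBall x r ⊆ {b' | ∀ i < n, b' i = b i} := by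
        intro b' hb'
        refine eq_of_abs_cantorMap_sub_le hl0 hlh n b' b ?_
        have h2 : |cantorMap l b' - cantorMap l b| ≤ 2 * r := by
          rw [← Real.dist_eq]
          linarith [dist_triangle_right (cantorMap l b') (cantorMap l b) x,
            Metric.mem_closedBall.1 hb, Metric.mem_closedBall.1 hb']
        refine h2.trans ?_
        rw [hy, div_le_iff₀ hgap] at hn2
        linarith
      refine (measure_mono hsub).trans ?_
      rw [coinMeasure_cylinder]
      refine ENNReal.ofReal_le_ofReal ?_
      have h3 : (l ^ (n + 1)) ^ s ≤ y ^ s := Real.rpow_le_rpow (by positivity) hn1.le hs0.le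
      rw [hls, pow_succ] at h3
      linarith
  · refine ⟨1 / 2, by norm_num, ?_⟩
    rintro _ ⟨b, rfl⟩ r hr hr1
    rw [Measure.map_apply hF.measurable Metric.isOpen_ball.measurableSet]
    obtain ⟨n, hn1, hn2⟩ := exists_nat_pow_near_of_lt_one hr hr1 hl0 hl1
    have hsub : {b' | ∀ i < n + 1, b' i = b i} ⊆
        cantorMap l ⁻¹' Metric.ball (cantorMap l b) r := by
      intro b' hb'
      rw [mem_preimage, Metric.mem_ball, Real.dist_eq]
      exact (abs_cantorMap_sub_le hl0 hl1 (n + 1) b' b hb').trans_lt hn1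
    refine le_trans ?_ (measure_mono hsub)
    rw [coinMeasure_cylinder]
    refine ENNReal.ofReal_le_ofReal ?_
    have h3 : r ^ s ≤ (l ^ n) ^ s := Real.rpow_le_rpow hr.le hn2 hs0.le
    rw [hls] at h3
    rw [pow_succ]
    linarith

theorem exists_isAhlforsRegular_Icc {s η : ℝ} (hs0 : 0 < s) (hs1 : s ≤ 1) (hη : 0 < η)
    (hη1 : η ≤ 1) : ∃ (K : Set ℝ) (μ : Measure ℝ), IsCompact K ∧ K ⊆ Icc 0 η ∧ K.Nonempty ∧
      IsFiniteMeasure μ ∧ IsAhlforsRegular μ K s := by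
  obtain ⟨K, μ, hK, hK1, hKn, hμ, h⟩ := exists_isAhlforsRegular_unit hs0 hs1
  refine ⟨_, _, hK.image (continuous_const_mul η), ?_, hKn.image _, Measure.isFiniteMeasure_map _ _,
    h.map_homeomorph (Homeomorph.mulLeft₀ η hη.ne') (one_le_inv_iff₀.2 ⟨hη, hη1⟩)
      (fun x y => ?_) fun x y => ?_⟩
  rotate_left
  · simp only [Homeomorph.coe_mulLeft₀, Real.dist_eq, ← mul_sub, abs_mul, abs_of_pos hη]
    exact mul_le_mul_of_nonneg_right (hη1.trans (one_le_inv_iff₀.2 ⟨hη, hη1⟩)) (abs_nonneg _)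
  · simp only [Homeomorph.coe_mulLeft₀, Real.dist_eq, ← mul_sub, abs_mul, abs_of_pos hη]
    rw [inv_mul_cancel_left₀ hη.ne']
  rintro _ ⟨x, hx, rfl⟩
  obtain ⟨h1, h2⟩ := hK1 hx
  exact ⟨by positivity, by simp only; nlinarith⟩

end
end Cantor

/-! ### Products of regular measures and the mass distribution principle. -/

section MassDistribution

/-- In the sup metric a ball is a product of balls, so the bounds multiply and the exponents add. -/
theorem IsAhlforsRegular.pi {ι : Type*} [Fintype ι] {μ : ι → Measure ℝ} [∀ i, IsFiniteMeasure (μ i)]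
    {K : ι → Set ℝ} {s : ι → ℝ} (h : ∀ i, IsAhlforsRegular (μ i) (K i) (s i)) :
    IsAhlforsRegular (Measure.pi μ) (univ.pi K) (∑ i, s i) := by
  choose C hC hup using fun i => (h i).exists_upper
  choose c hc hlow using fun i => (h i).exists_lower
  have key : ∀ (a : ι → ℝ), (∀ i, 0 < a i) → ∀ r : ℝ, 0 < r →
      ∏ i, ENNReal.ofReal (a i * r ^ s i) = ENNReal.ofReal ((∏ i, a i) * r ^ ∑ i, s i) := by
    intro a ha r hr
    rw [← ENNReal.ofReal_prod_of_nonneg fun i _ => mul_nonneg (ha i).le (by positivity),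
      Finset.prod_mul_distrib, Real.rpow_sum_of_pos hr]
  refine ⟨?_, ⟨∏ i, C i, Finset.prod_pos fun i _ => hC i, fun x r hr => ?_⟩,
    ⟨∏ i, c i, Finset.prod_pos fun i _ => hc i, fun x hx r hr hr1 => ?_⟩⟩
  · have h1 : ∀ i, ∀ᵐ x ∂μ i, x ∈ K i := fun i => (h i).measure_compl
    have h2 : ∀ᵐ x ∂Measure.pi μ, ∀ i, x i ∈ K i :=
      eventually_all.2 fun i => Measure.tendsto_eval_ae_ae.eventually (h1 i)
    refine measure_mono_null (fun x hx => ?_) h2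
    simpa [mem_univ_pi] using hx
  · rw [Measure.pi_closedBall _ _ hr.le, ← key C hC r hr]
    exact Finset.prod_le_prod' fun i _ => hup i _ _ hr
  · rw [Measure.pi_ball _ _ hr, ← key c hc r hr]
    exact Finset.prod_le_prod' fun i _ => hlow i _ (hx i (mem_univ i)) _ hr hr1

/-- The mass distribution principle. -/
theorem IsAhlforsRegular.ofReal_le_dimH {X : Type*} [MetricSpace X] [MeasurableSpace X]
    [BorelSpace X] {μ : Measure X} {E : Set X} {s : ℝ} (h : IsAhlforsRegular μ E s) (hs : 0 < s)
    (hE : E.Nonempty) : ENNReal.ofReal s ≤ dimH E := by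
  obtain ⟨C, hC, hup⟩ := h.exists_upper
  obtain ⟨c, hc, hlow⟩ := h.exists_lower
  obtain ⟨x, hx⟩ := hE
  have hμE : μ E ≠ 0 := by
    have h1 : 0 < μ (Metric.ball x 1) :=
      lt_of_lt_of_le (by simpa using hc) (hlow x hx 1 one_pos le_rfl)
    intro h0
    refine h1.ne' (measure_mono_null (subset_univ _) ?_)
    rw [← union_compl_self E]
    exact measure_union_null h0 h.measure_compl
  have hC0 : ENNReal.ofReal C ≠ 0 := by simpa using hC
  have hle : (ENNReal.ofReal C)⁻¹ • μ ≤ Measure.hausdorffMeasure s := by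
    refine Measure.le_hausdorffMeasure _ _ 1 one_pos fun S hS => ?_
    rcases S.eq_empty_or_nonempty with rfl | ⟨y, hy⟩
    · simp
    have hfin : Metric.ediam S ≠ ∞ := ne_top_of_le_ne_top ENNReal.one_ne_top hS
    set D := (Metric.ediam S).toReal with hD
    -- Regularity needs a positive radius, so radii above the diameter are used and then decrease to
    -- it; this covers sets of diameter zero.
    have h1 : ∀ ρ, D < ρ → μ S ≤ ENNReal.ofReal (C * ρ ^ s) := by
      intro ρ hρ
      refine (measure_mono fun z hz => ?_).trans (hup y ρ (ENNReal.toReal_nonneg.trans_lt hρ))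
      rw [Metric.mem_closedBall, dist_edist]
      exact (ENNReal.toReal_mono hfin (Metric.edist_le_ediam_of_mem hz hy)).trans hρ.le
    have h2 : Tendsto (fun ρ : ℝ => ENNReal.ofReal (C * ρ ^ s)) (𝓝[>] D)
        (𝓝 (ENNReal.ofReal (C * D ^ s))) := by
      refine (ENNReal.continuous_ofReal.comp (continuous_const.mul
        (Real.continuous_rpow_const hs.le))).continuousAt.mono_left nhdsWithin_le_nhds
    have h3 : μ S ≤ ENNReal.ofReal (C * D ^ s) :=
      ge_of_tendsto h2 (eventually_mem_nhdsWithin.mono h1)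
    rw [Measure.smul_apply, smul_eq_mul]
    refine (mul_le_mul_right h3 _).trans (le_of_eq ?_)
    rw [ENNReal.ofReal_mul hC.le, ← mul_assoc, ENNReal.inv_mul_cancel hC0 ENNReal.ofReal_ne_top,
      one_mul, ← ENNReal.ofReal_rpow_of_nonneg ENNReal.toReal_nonneg hs.le,
      ENNReal.ofReal_toReal hfin]
  refine le_dimH_of_hausdorffMeasure_ne_zero (d := s.toNNReal) ?_
  rw [Real.coe_toNNReal _ hs.le]
  refine (lt_of_lt_of_le ?_ (hle E)).ne'
  rw [Measure.smul_apply, smul_eq_mul, pos_iff_ne_zero]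
  exact mul_ne_zero (ENNReal.inv_ne_zero.2 ENNReal.ofReal_ne_top) hμE

end MassDistribution

/-! ### Ahlfors regular compact sets are admissible. -/

section DiscreteRegular

/-- Passage from the sup metric, natural for products, to the Euclidean one; they are bi-Lipschitz
equivalent. -/
theorem IsAhlforsRegular.toLp {d : ℕ} {μ : Measure (Fin d → ℝ)} {E : Set (Fin d → ℝ)} {s : ℝ}
    (h : IsAhlforsRegular μ E s) :
    IsAhlforsRegular (μ.map (WithLp.toLp 2 : _ → EuclideanSpace ℝ (Fin d)))
      (WithLp.ofLp ⁻¹' E) s := by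
  have key := h.map_homeomorph (PiLp.homeomorph 2 (fun _ : Fin d => ℝ)).symm
    (κ := (d : ℝ) + 1) (by linarith [(Nat.cast_nonneg d : (0 : ℝ) ≤ d)]) ?_ ?_
  · rw [Homeomorph.image_symm] at key
    exact key
  · intro x y
    refine ((PiLp.lipschitzWith_toLp 2 (fun _ : Fin d => ℝ)).dist_le_mul x y).trans ?_
    refine mul_le_mul_of_nonneg_right ?_ dist_nonneg
    rw [NNReal.coe_rpow]
    simp only [Fintype.card_fin, NNReal.coe_natCast]
    rcases Nat.eq_zero_or_pos d with rfl | hd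
    · norm_num
    · have : (1 : ℝ) ≤ d := by exact_mod_cast hd
      refine (Real.rpow_le_rpow_of_exponent_le this (z := 1) (by norm_num)).trans ?_
      rw [Real.rpow_one]; linarith
  · intro x y
    refine ((PiLp.antilipschitzWith_toLp 2 (fun _ : Fin d => ℝ)).le_mul_dist x y).trans ?_
    refine mul_le_mul_of_nonneg_right ?_ dist_nonneg
    simp

variable {d : ℕ} {ν : Measure (EuclideanSpace ℝ (Fin d))} {E : Set (EuclideanSpace ℝ (Fin d))}
  {α : ℝ}

/-- Double counting of the integral of `ν(B(y, 2δ))` over `y ∈ B(x, r)`: each `y` near `E`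
contributes at least `c δ^α`, while by Fubini only `z ∈ B(x, 3r)` matter, each contributing at most
the volume of a ball of radius `2δ`. -/
theorem IsAhlforsRegular.exists_volume_thickening_le [IsFiniteMeasure ν]
    (h : IsAhlforsRegular ν E α) :
    ∃ C : ℝ, 0 < C ∧ ∀ x δ r, 0 < δ → δ ≤ 1 → δ ≤ r →
      volume (Metric.thickening δ E ∩ Metric.ball x r) ≤
        ENNReal.ofReal (C * (r / δ) ^ α * δ ^ (d : ℝ)) := by
  obtain ⟨C, hC, hup⟩ := h.exists_upper
  obtain ⟨c, hc, hlow⟩ := h.exists_lower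
  set v := (volume (Metric.ball (0 : EuclideanSpace ℝ (Fin d)) 1)).toReal with hv
  have hv0 : 0 < v := ENNReal.toReal_pos (Metric.measure_ball_pos _ _ one_pos).ne'
    measure_ball_lt_top.ne
  have hvol : ∀ z : EuclideanSpace ℝ (Fin d), ∀ ρ, 0 < ρ →
      volume (Metric.ball z ρ) = ENNReal.ofReal (ρ ^ d * v) := by
    intro z ρ hρ
    rw [Measure.addHaar_ball_of_pos _ _ hρ, finrank_euclideanSpace_fin,
      ENNReal.ofReal_mul (by positivity), hv, ENNReal.ofReal_toReal measure_ball_lt_top.ne]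
  refine ⟨C * 3 ^ α * (2 ^ d * v) / c, by positivity, fun x δ r hδ hδ1 hr => ?_⟩
  have hr0 : 0 < r := hδ.trans_le hr
  set B := Metric.ball x r
  have hS : MeasurableSet {p : EuclideanSpace ℝ (Fin d) × EuclideanSpace ℝ (Fin d) |
      dist p.1 p.2 < 2 * δ} := (isOpen_lt continuous_dist continuous_const).measurableSet
  have h1 : ENNReal.ofReal (c * δ ^ α) * volume (Metric.thickening δ E ∩ B) ≤
      ∫⁻ y in B, ν (Metric.ball y (2 * δ)) := by
    have hT : MeasurableSet (Metric.thickening δ E ∩ B) :=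
      Metric.isOpen_thickening.measurableSet.inter Metric.isOpen_ball.measurableSet
    rw [← setLIntegral_const]
    refine (setLIntegral_mono' hT fun y hy => ?_).trans (lintegral_mono_set inter_subset_right)
    obtain ⟨z, hz, hyz⟩ := Metric.mem_thickening_iff.1 hy.1
    refine (hlow z hz δ hδ hδ1).trans (measure_mono (Metric.ball_subset_ball' ?_))
    rw [dist_comm]; linarith
  have h2 : ∫⁻ y in B, ν (Metric.ball y (2 * δ)) =
      ∫⁻ z, volume (Metric.ball z (2 * δ) ∩ B) ∂ν := by
    have e1 := Measure.prod_apply (μ := volume.restrict B) (ν := ν) hS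
    have e2 := Measure.prod_apply_symm (μ := volume.restrict B) (ν := ν) hS
    rw [e1] at e2
    convert e2 using 1
    · refine lintegral_congr fun y => congrArg ν ?_
      ext z; simp [dist_comm]
    · refine lintegral_congr fun z => ?_
      rw [← Measure.restrict_apply Metric.isOpen_ball.measurableSet]
      rfl
  have h3 : ∫⁻ z, volume (Metric.ball z (2 * δ) ∩ B) ∂ν ≤
      ENNReal.ofReal ((2 * δ) ^ d * v) * ENNReal.ofReal (C * (3 * r) ^ α) := by
    calc ∫⁻ z, volume (Metric.ball z (2 * δ) ∩ B) ∂ν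
        ≤ ∫⁻ z in Metric.closedBall x (3 * r), ENNReal.ofReal ((2 * δ) ^ d * v) ∂ν := by
          rw [← lintegral_indicator Metric.isClosed_closedBall.measurableSet]
          refine lintegral_mono fun z => ?_
          by_cases hz : z ∈ Metric.closedBall x (3 * r)
          · rw [indicator_of_mem hz, ← hvol z (2 * δ) (by positivity)]
            exact measure_mono inter_subset_left
          · rw [indicator_of_notMem hz, nonpos_iff_eq_zero]
            convert measure_empty (μ := (volume : Measure (EuclideanSpace ℝ (Fin d))))
            refine eq_empty_of_forall_notMem fun y hy => hz ?_
            have e1 : dist y z < 2 * δ := hy.1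
            have e2 : dist y x < r := hy.2
            rw [Metric.mem_closedBall]
            linarith [dist_triangle_left z x y]
      _ ≤ _ := by
          rw [setLIntegral_const]
          exact mul_le_mul_right (hup x _ (by positivity)) _
  have h4 := h1.trans (h2.le.trans h3)
  have hcδ : 0 < c * δ ^ α := by positivity
  rw [mul_comm, ← ENNReal.le_div_iff_mul_le (Or.inl (by simpa using hcδ))
    (Or.inl ENNReal.ofReal_ne_top), ← ENNReal.ofReal_mul (by positivity),
    ← ENNReal.ofReal_div_of_pos hcδ] at h4
  refine h4.trans (le_of_eq (congrArg ENNReal.ofReal ?_))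
  rw [Real.mul_rpow (by norm_num) hr0.le, Real.div_rpow hr0.le hδ.le, Real.rpow_natCast, mul_pow]
  field_simp

theorem IsAhlforsRegular.isDiscreteRegular [IsFiniteMeasure ν] (h : IsAhlforsRegular ν E α) :
    IsDiscreteRegular E α := by
  obtain ⟨C, hC, hvol⟩ := h.exists_volume_thickening_le
  refine ⟨fun i => 1 / ((i : ℝ) + 1), fun i => by positivity, tendsto_one_div_add_atTop_nhds_zero_nat,
    1, one_pos, fun ε hε _ => ⟨C, hC, fun i x r hr => ?_⟩⟩
  set δ : ℝ := 1 / ((i : ℝ) + 1)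
  have hδ : 0 < δ := by positivity
  have hδ1 : δ ≤ 1 := by
    rw [div_le_one (by positivity)]; linarith [(Nat.cast_nonneg i : (0 : ℝ) ≤ i)]
  refine (hvol x δ r hδ hδ1 hr).trans (ENNReal.ofReal_le_ofReal ?_)
  have h1 : 1 ≤ r / δ := (one_le_div hδ).2 hr
  gcongr ?_ * ?_ * ?_
  · exact Real.rpow_le_rpow_of_exponent_le h1 (by linarith)
  · exact Real.rpow_le_rpow_of_exponent_ge hδ hδ1 (by linarith)

theorem IsAhlforsRegular.dimH_le [IsFiniteMeasure ν] (h : IsAhlforsRegular ν E α) (hα : 0 ≤ α)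
    (hE : Bornology.IsBounded E) : dimH E ≤ ENNReal.ofReal α := by
  obtain ⟨C, hC, hvol⟩ := h.exists_volume_thickening_le
  obtain ⟨R, hR, hER⟩ := hE.subset_ball_lt 0 0
  set v := (volume (Metric.ball (0 : EuclideanSpace ℝ (Fin d)) 1)).toReal with hv
  have hv0 : 0 < v := ENNReal.toReal_pos (Metric.measure_ball_pos _ _ one_pos).ne'
    measure_ball_lt_top.ne
  refine (dimension_le_of_measure_thickening_le (μ := volume) (c := v) (D := d) hv0
    (fun x r hr => ?_) hα (δ := fun i => 1 / ((i : ℝ) + 1)) (fun i => by positivity)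
    tendsto_one_div_add_atTop_nhds_zero_nat fun b hb => ?_).2
  · rw [Measure.addHaar_ball_of_pos _ _ hr, finrank_euclideanSpace_fin, Real.rpow_natCast, mul_comm,
      ENNReal.ofReal_mul (by positivity), hv, ENNReal.ofReal_toReal measure_ball_lt_top.ne]
  · refine ⟨C * (R + 1) ^ α, Eventually.of_forall fun i => ?_⟩
    set δ : ℝ := 1 / ((i : ℝ) + 1)
    have hδ : 0 < δ := by positivity
    have hδ1 : δ ≤ 1 := by
      rw [div_le_one (by positivity)]; linarith [(Nat.cast_nonneg i : (0 : ℝ) ≤ i)]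
    have hsub : Metric.thickening δ E ⊆ Metric.thickening δ E ∩ Metric.ball 0 (R + 1) := by
      refine fun y hy => ⟨hy, ?_⟩
      obtain ⟨z, hz, hyz⟩ := Metric.mem_thickening_iff.1 hy
      have := Metric.mem_ball.1 (hER hz)
      rw [Metric.mem_ball]
      linarith [dist_triangle y z 0]
    refine (measure_mono hsub).trans ((hvol 0 δ (R + 1) hδ hδ1 (by linarith)).trans
      (ENNReal.ofReal_le_ofReal ?_))
    rw [Real.div_rpow (by positivity) hδ.le, Real.rpow_sub hδ, ← mul_div_assoc, div_mul_eq_mul_div,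
      ← mul_div_assoc]
    exact div_le_div_of_nonneg_left (by positivity) (by positivity)
      (Real.rpow_le_rpow_of_exponent_ge hδ hδ1 hb.le)

theorem IsAhlforsRegular.isAdmissible [IsFiniteMeasure ν] (h : IsAhlforsRegular ν E α) (hα : 0 < α)
    (hE : IsCompact E) (hne : E.Nonempty) : IsAdmissible α E :=
  ⟨hE, (h.dimH_le hα.le hE.isBounded).antisymm (h.ofReal_le_dimH hα hne), h.isDiscreteRegular⟩

end DiscreteRegular

/-! ### Sharpness: an interval times a power of a Cantor set. -/

section Example

theorem exists_pos_nat_mul_sq_lt {k : ℕ} (n : ℕ) {t : Fin k → ℝ} (ht : ∀ i, 0 < t i) :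
    ∃ η : ℝ, 0 < η ∧ η ≤ 1 ∧ ∀ i, n * η ^ 2 < t i ^ 2 := by
  have h1 : ∀ᶠ η : ℝ in 𝓝[>] 0, ∀ i, n * η ^ 2 < t i ^ 2 := by
    refine eventually_all.2 fun i => ?_
    have hc : Tendsto (fun η : ℝ => n * η ^ 2) (𝓝[>] 0) (𝓝 (n * 0 ^ 2)) :=
      (Continuous.tendsto (by fun_prop) 0).mono_left nhdsWithin_le_nhds
    exact hc.eventually_lt_const (by have := ht i; simp; positivity)
  obtain ⟨η, hη, hη0, hη1⟩ := (h1.and (Ioc_mem_nhdsGT one_pos)).exists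
  exact ⟨η, hη0, hη1, hη⟩

/-- The first coordinate of the first vertex of a chain, together with all the coordinates but the
first of all its vertices. -/
def chainCoords (n k : ℕ) (x : Fin (k + 1) → EuclideanSpace ℝ (Fin (n + 1))) :
    Option (Fin (k + 1) × Fin n) → ℝ :=
  fun o => o.elim (x 0 0) fun p => x p.1 p.2.succ

theorem lipschitzWith_chainCoords (n k : ℕ) : LipschitzWith 1 (chainCoords n k) := by
  have key : ∀ (x y : Fin (k + 1) → EuclideanSpace ℝ (Fin (n + 1))) j l,
      dist (x j l) (y j l) ≤ dist x y := by
    intro x y j l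
    refine (dist_le_pi_dist (x j).ofLp (y j).ofLp l).trans ?_
    refine ((PiLp.lipschitzWith_ofLp 2 (fun _ : Fin (n + 1) => ℝ)).dist_le_mul _ _).trans ?_
    simpa using dist_le_pi_dist x y j
  refine LipschitzWith.of_dist_le_mul fun x y => ?_
  rw [NNReal.coe_one, one_mul, dist_pi_le_iff dist_nonneg]
  rintro (_ | ⟨j, l⟩)
  · exact key x y 0 0
  · exact key x y j l.succ

variable {n k : ℕ} {t : Fin k → ℝ}

/-- The Cantor coordinates of all vertices are prescribed; smallness of `η` keeps their
displacements shorter than the gaps, and the first coordinates make up the missing lengths. -/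
theorem pi_subset_image_chainSet (ht : ∀ i, 0 < t i) {η : ℝ} (hη : ∀ i, n * η ^ 2 < t i ^ 2)
    {K : Set ℝ} (hK : K ⊆ Icc 0 η) :
    (univ.pi fun o : Option (Fin (k + 1) × Fin n) => o.elim (Icc 0 1) fun _ => K) ⊆
      chainCoords n k '' chainSet t (WithLp.ofLp ⁻¹'
        univ.pi (Fin.cons (α := fun _ => Set ℝ) (Icc 0 (1 + ∑ i, t i)) fun _ : Fin n => K)) := by
  intro q hq
  have hq0 : q none ∈ Icc (0 : ℝ) 1 := hq none (mem_univ _)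
  have hqK : ∀ j l, q (some (j, l)) ∈ K := fun j l => hq (some (j, l)) (mem_univ _)
  set D : Fin k → ℝ := fun i => ∑ l, (q (some (i.castSucc, l)) - q (some (i.succ, l))) ^ 2 with hD
  have hD0 : ∀ i, 0 ≤ D i := fun i => Finset.sum_nonneg fun l _ => sq_nonneg _
  have hDt : ∀ i, D i < t i ^ 2 := by
    intro i
    refine lt_of_le_of_lt ?_ (hη i)
    calc D i ≤ ∑ _l : Fin n, η ^ 2 := by
          refine Finset.sum_le_sum fun l _ => sq_le_sq' ?_ ?_
          · linarith [(hK (hqK i.castSucc l)).1, (hK (hqK i.succ l)).2]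
          · linarith [(hK (hqK i.castSucc l)).2, (hK (hqK i.succ l)).1]
      _ = _ := by simp
  -- The step in the first coordinate that Pythagoras forces, taken positive at every link. The
  -- first coordinates therefore increase strictly, which makes the vertices distinct.
  set h : Fin k → ℝ := fun i => Real.sqrt (t i ^ 2 - D i) with hh
  have hpos : ∀ i, 0 < h i := fun i => Real.sqrt_pos.2 (sub_pos.2 (hDt i))
  have hle : ∀ i, h i ≤ t i := fun i =>
    Real.sqrt_le_iff.2 ⟨(ht i).le, by linarith [hD0 i]⟩
  have hsq : ∀ i, h i ^ 2 = t i ^ 2 - D i := fun i => Real.sq_sqrt (sub_pos.2 (hDt i)).le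
  set y : Fin (k + 1) → ℝ := fun j => q none + ∑ i : Fin k, if i.castSucc < j then h i else 0 with hy
  have hy0 : y 0 = q none := by simp [hy]
  have hstep : ∀ i : Fin k, y i.succ - y i.castSucc = h i := by
    intro i
    simp only [hy, add_sub_add_left_eq_sub, ← Finset.sum_sub_distrib]
    rw [Finset.sum_eq_single i]
    · simp
    · intro l _ hl
      have : l.castSucc < i.succ ↔ l.castSucc < i.castSucc := by
        rw [Fin.castSucc_lt_succ_iff, Fin.castSucc_lt_castSucc_iff]
        exact ⟨fun h => lt_of_le_of_ne h hl, le_of_lt⟩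
      simp [this]
    · simp
  have hymono : StrictMono y := Fin.strictMono_iff_lt_succ.2 fun i => by
    linarith [hstep i, hpos i]
  -- Each step is at most its gap, and the start is at most `1`: hence the length of the interval
  -- factor.
  have hyI : ∀ j, y j ∈ Icc 0 (1 + ∑ i, t i) := by
    intro j
    refine ⟨add_nonneg hq0.1 (Finset.sum_nonneg fun i _ => ?_),
      add_le_add hq0.2 (Finset.sum_le_sum fun i _ => ?_)⟩
    · split_ifs
      exacts [(hpos i).le, le_rfl]
    · split_ifs
      exacts [hle i, (ht i).le]
  refine ⟨fun j => WithLp.toLp 2 (Fin.cons (α := fun _ => ℝ) (y j) fun l => q (some (j, l))),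
    ⟨fun j => ?_, fun i => ?_, fun j j' hjj => ?_⟩, ?_⟩
  · rw [mem_preimage, mem_univ_pi]
    refine Fin.cases ?_ fun l => ?_
    · exact hyI j
    · exact hqK j l
  · rw [EuclideanSpace.dist_eq, Fin.sum_univ_succ]
    simp only [Fin.cons_zero, Fin.cons_succ, Real.dist_eq, sq_abs]
    rw [← neg_sub, hstep, neg_sq, hsq]
    change Real.sqrt (t i ^ 2 - D i + D i) = t i
    rw [sub_add_cancel, Real.sqrt_sq (ht i).le]
  · have := congrArg (fun v : EuclideanSpace ℝ (Fin (n + 1)) => v 0) hjj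
    exact hymono.injective this
  · funext o
    rcases o with _ | ⟨j, l⟩
    · exact hy0
    · rfl

theorem exists_isAdmissible_le_dimH_chainSet (hn : 1 ≤ n) (ht : ∀ i, 0 < t i) {α : ℝ} (hα : 1 < α)
    (hαn : α ≤ n + 1) : ∃ E : Set (EuclideanSpace ℝ (Fin (n + 1))), IsAdmissible α E ∧
      ENNReal.ofReal (((k : ℝ) + 1) * α - k) ≤ dimH (chainSet t E) := by
  have hn0 : (0 : ℝ) < n := by exact_mod_cast hn
  -- Makes the dimension of the product `1 + n s = α`; positivity of `s` is where `α > 1` enters.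
  set s := (α - 1) / n with hs
  have hns : n * s = α - 1 := mul_div_cancel₀ _ hn0.ne'
  have hs0 : 0 < s := div_pos (by linarith) hn0
  have hs1 : s ≤ 1 := (div_le_one hn0).2 (by linarith)
  obtain ⟨η, hη0, hη1, hη⟩ := exists_pos_nat_mul_sq_lt n ht
  obtain ⟨K, μ, hK, hKη, hKne, hμ, hreg⟩ := exists_isAhlforsRegular_Icc hs0 hs1 hη0 hη1
  set L := 1 + ∑ i, t i with hL
  have hL0 : 0 < L := add_pos_of_pos_of_nonneg one_pos (Finset.sum_nonneg fun i _ => (ht i).le)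
  set P := Fin.cons (α := fun _ => Set ℝ) (Icc 0 L) fun _ : Fin n => K with hP
  refine ⟨WithLp.ofLp ⁻¹' univ.pi P, ?_, ?_⟩
  · set m := Fin.cons (α := fun _ => Measure ℝ) (volume.restrict (Icc 0 L)) fun _ : Fin n => μ
    have hm : ∀ i, IsFiniteMeasure (m i) := Fin.cases
      (inferInstanceAs (IsFiniteMeasure (volume.restrict (Icc 0 L)))) fun _ => hμ
    have hr : ∀ i, IsAhlforsRegular (m i) (P i) (Fin.cons (α := fun _ => ℝ) 1 (fun _ => s) i) :=
      Fin.cases (isAhlforsRegular_Icc hL0) fun _ => hreg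
    have hreg' := (IsAhlforsRegular.pi hr).toLp
    have hsum : ∑ i : Fin (n + 1), Fin.cons (α := fun _ => ℝ) 1 (fun _ => s) i = α := by
      rw [Fin.sum_univ_succ]
      simp [hns]
    rw [hsum] at hreg'
    refine hreg'.isAdmissible (by linarith) ?_ ?_
    · have hc : IsCompact (univ.pi P) := isCompact_univ_pi (Fin.cases isCompact_Icc fun _ => hK)
      exact (PiLp.homeomorph 2 (fun _ : Fin (n + 1) => ℝ)).isCompact_preimage.2 hc
    · have hne : (univ.pi P).Nonempty :=
        univ_pi_nonempty_iff.2 (Fin.cases (nonempty_Icc.2 hL0.le) fun _ => hKne)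
      exact hne.preimage (PiLp.homeomorph 2 (fun _ : Fin (n + 1) => ℝ)).surjective
  · set m : Option (Fin (k + 1) × Fin n) → Measure ℝ :=
      fun o => o.elim (volume.restrict (Icc 0 1)) fun _ => μ
    set Q : Option (Fin (k + 1) × Fin n) → Set ℝ := fun o => o.elim (Icc 0 1) fun _ => K
    have hm : ∀ o, IsFiniteMeasure (m o) := by
      rintro (_ | _)
      exacts [inferInstanceAs (IsFiniteMeasure (volume.restrict (Icc 0 1))), hμ]
    have hr : ∀ o, IsAhlforsRegular (m o) (Q o) (o.elim 1 fun _ => s) := by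
      rintro (_ | _)
      exacts [isAhlforsRegular_Icc one_pos, hreg]
    -- One free interval coordinate and `n(k+1)` Cantor coordinates: `1 + (k+1)(α-1)`.
    have hsum : ∑ o : Option (Fin (k + 1) × Fin n), o.elim 1 (fun _ => s) =
        ((k : ℝ) + 1) * α - k := by
      rw [Fintype.sum_option]
      simp only [Option.elim, Finset.sum_const, Finset.card_univ, Fintype.card_prod,
        Fintype.card_fin, nsmul_eq_mul]
      push_cast
      rw [mul_assoc, hns]
      ring
    have hk : (0 : ℝ) ≤ k := Nat.cast_nonneg k
    have h1 : ENNReal.ofReal (((k : ℝ) + 1) * α - k) ≤ dimH (univ.pi Q) := by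
      rw [← hsum]
      refine (IsAhlforsRegular.pi hr).ofReal_le_dimH ?_ (univ_pi_nonempty_iff.2 ?_)
      · rw [hsum]; nlinarith
      · rintro (_ | _)
        exacts [nonempty_Icc.2 zero_le_one, hKne]
    refine h1.trans ((dimH_mono (pi_subset_image_chainSet ht hη hKη)).trans ?_)
    exact (lipschitzWith_chainCoords n k).dimH_image_le _

end Example

theorem theorem1p6 (d k : ℕ) (hd : 2 ≤ d) (hk : 1 ≤ k) (t : Fin k → ℝ) (ht : ∀ i, 0 < t i)
    (α : ℝ) (hα : 0 < α) :
    (((d : ℝ) + 1) / 2 ≤ α → α ≤ d →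
      chainDimSup d t α = ENNReal.ofReal (((k : ℝ) + 1) * α - k) ∧
      ∀ E : Set (EuclideanSpace ℝ (Fin d)), IsAdmissible α E →
        lowerMinkowskiDim (chainSet t E) ≤ ((((k : ℝ) + 1) * α - k : ℝ) : EReal)) ∧
    (α ≤ ((d : ℝ) + 1) / 2 →
      chainDimSup d t α ≤ ENNReal.ofReal ((k : ℝ) * ((d : ℝ) - 1) / 2 + α) ∧
      ∀ E : Set (EuclideanSpace ℝ (Fin d)), IsAdmissible α E →
        lowerMinkowskiDim (chainSet t E) ≤
          (((k : ℝ) * ((d : ℝ) - 1) / 2 + α : ℝ) : EReal)) := by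
  obtain ⟨n, rfl⟩ : ∃ n, d = n + 1 := ⟨d - 1, by omega⟩
  have hn : 1 ≤ n := by omega
  have hn' : (1 : ℝ) ≤ n := by exact_mod_cast hn
  have hk0 : (0 : ℝ) ≤ k := Nat.cast_nonneg k
  push_cast
  constructor
  · intro h1 h2
    have hupper : ∀ E : Set (EuclideanSpace ℝ (Fin (n + 1))), IsAdmissible α E →
        lowerMinkowskiDim (chainSet t E) ≤ ((((k : ℝ) + 1) * α - k : ℝ) : EReal) ∧
        dimH (chainSet t E) ≤ ENNReal.ofReal (((k : ℝ) + 1) * α - k) := by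
      intro E hE
      -- Above the threshold the shell operators incur no loss.
      have := dimension_chainSet_le ht (γ := 0) le_rfl (by linarith) hE.isCompact.isBounded
        hE.regular (by nlinarith)
      simpa only [mul_zero, add_zero] using this
    refine ⟨le_antisymm (iSup₂_le fun E hE => (hupper E hE).2) ?_, fun E hE => (hupper E hE).1⟩
    obtain ⟨E, hE, hdim⟩ := exists_isAdmissible_le_dimH_chainSet hn ht (α := α) (by linarith) h2
    exact hdim.trans (le_iSup₂ (f := fun E (_ : IsAdmissible α E) => dimH (chainSet t E)) E hE)
  · intro h1
    -- Below the threshold the loss is `γ = (d+1)/2 - α` per link, and the general exponent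
    -- simplifies to the stated one.
    have hγ : ((k : ℝ) + 1) * α - k + k * (((n : ℝ) + 2) / 2 - α) =
        (k : ℝ) * ((n : ℝ) + 1 - 1) / 2 + α := by ring
    have hupper : ∀ E : Set (EuclideanSpace ℝ (Fin (n + 1))), IsAdmissible α E →
        lowerMinkowskiDim (chainSet t E) ≤
          (((k : ℝ) * ((n : ℝ) + 1 - 1) / 2 + α : ℝ) : EReal) ∧
        dimH (chainSet t E) ≤ ENNReal.ofReal ((k : ℝ) * ((n : ℝ) + 1 - 1) / 2 + α) := by
      intro E hE
      rw [← hγ]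
      refine dimension_chainSet_le ht (by linarith) le_rfl hE.isCompact.isBounded hE.regular ?_
      rw [hγ]
      have : 0 ≤ (k : ℝ) * n := by positivity
      linarith
    exact ⟨iSup₂_le fun E hE => (hupper E hE).2, fun E hE => (hupper E hE).1⟩
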